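/- Let $\mathbb{K}$ be a field, $R$ a commutative noetherian $\mathbb{K}$-algebra, and $\Gamma$ a module-finite (not necessarily commutative) $R$-algebra. By a $\Gamma$-bimodule we mean a $\Gamma\otimes_R\Gamma^{\mathrm{op}}$-module, i.e. a bimodule on which $R$ acts centrally; for a maximal ideal $\mathfrak m$ of $R$, the localization $M_{\mathfrak m}=M\otimes_R R_{\mathfrak m}$ of a $\Gamma$-bimodule (or of a complex of such) is then a (complex of) $\Gamma_{\mathfrak m}$-bimodule(s), where $\Gamma_{\mathfrak m}=\Gamma\otimes_R R_{\mathfrak m}$. For a ring $A$, a complex $M$ of $A$-bimodules is called biperfect if it is perfect both as a complex of right $A$-modules and as a complex of left $A$-modules, where a complex is perfect if it is quasi-isomorphic to a bounded complex of finitely generated projective modules. It is called tilting if it is biperfect, the left multiplication map $A\to \mathbf{R}\mathrm{Hom}_{A}(M,M)$ (derived endomorphisms of $M$ as a complex of right modules) is an isomorphism in the derived category, and the right multiplication map $A\to \mathbf{R}\mathrm{Hom}_{A^{\mathrm{op}}}(M,M)$ (derived endomorphisms of $M$ as a complex of left modules) is an isomorphism in the derived category. A bimodule is called tilting if it is tilting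 as a complex concentrated in degree $0$. (1) Let $M$ be a biperfect complex of finitely generated $\Gamma$-bimodules. If $M_{\mathfrak m}$ is a tilting complex of $\Gamma_{\mathfrak m}$-bimodules for every maximal ideal $\mathfrak m$ of $R$, then $M$ is tilting. (2) Let $M$ be a finitely generated $\Gamma$-bimodule. If there is an integer $n\ge 0$ such that for every maximal ideal $\mathfrak m$ of $R$ one has $\mathrm{pd}_{\Gamma_{\mathfrak m}}(M_{\mathfrak m})\le n$, $\mathrm{pd}_{\Gamma_{\mathfrak m}^{\mathrm{op}}}(M_{\mathfrak m})\le n$, and $M_{\mathfrak m}$ is tilting, then $M$ is tilting. -/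

import Mathlib

open CategoryTheory TensorProduct MulOpposite

universe u

noncomputable section

namespace TiltingBimod

/-! ### Bimodules and one-sided restriction -/

/-- The enveloping algebra `A ⊗[k] Aᵐᵒᵖ`. A module over it is an `A`-bimodule on which
the two actions of `k` agree. -/
abbrev Env (k A : Type u) [CommRing k] [Ring A] [Algebra k A] : Type u := A ⊗[k] Aᵐᵒᵖ

section Restriction

variable (k A : Type u) [CommRing k] [Ring A] [Algebra k A]

/-- `a ↦ a ⊗ 1`, through which a bimodule is a left `A`-module. -/
abbrev inl : A →+* Env k A :=
  (Algebra.TensorProduct.includeLeft : A →ₐ[k] A ⊗[k] Aᵐᵒᵖ).toRingHom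

/-- `b ↦ 1 ⊗ b`, through which a bimodule is a right `A`-module, i.e. an `Aᵐᵒᵖ`-module. -/
abbrev inr : Aᵐᵒᵖ →+* Env k A :=
  (Algebra.TensorProduct.includeRight : Aᵐᵒᵖ →ₐ[k] A ⊗[k] Aᵐᵒᵖ).toRingHom

lemma commute_inl_inr (a : A) (b : Aᵐᵒᵖ) : Commute (inl k A a) (inr k A b) := by
  simp [Commute, SemiconjBy]

/-- The underlying left module of a bimodule. -/
abbrev leftRes : ModuleCat.{u} (Env k A) ⥤ ModuleCat.{u} A :=
  ModuleCat.restrictScalars (inl k A)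

/-- The underlying right module of a bimodule. -/
abbrev rightRes : ModuleCat.{u} (Env k A) ⥤ ModuleCat.{u} Aᵐᵒᵖ :=
  ModuleCat.restrictScalars (inr k A)

end Restriction

/-! ### Perfect complexes -/

/-- A complex of `S`-modules is perfect if it is quasi-isomorphic to a bounded complex of
finitely generated projective modules. (Such a complex `P` is K-projective, so that an
isomorphism in the derived category is represented by a quasi-isomorphism out of `P`.) -/
def IsPerfect {S : Type u} [Ring S] (X : CochainComplex (ModuleCat.{u} S) ℤ) : Prop :=
  ∃ (P : CochainComplex (ModuleCat.{u} S) ℤ) (p : P ⟶ X),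
    (∃ a b : ℤ, ∀ i, i < a ∨ b < i → Limits.IsZero (P.X i)) ∧
    (∀ i, Module.Finite S (P.X i) ∧ Module.Projective S (P.X i)) ∧
    QuasiIso p

/-! ### Multiplication maps into the derived endomorphism complex -/

section Multiplication

variable {E S T : Type u} [Ring E] [Ring S] [Ring T]
  (f : S →+* E) (g : T →+* E) (h : ∀ s t, Commute (f s) (g t))

/-- The action of `t : T` on the `E`-module `X`, as an `S`-linear endomorphism. -/
def actHom (t : T) (X : ModuleCat.{u} E) :
    (ModuleCat.restrictScalars f).obj X ⟶ (ModuleCat.restrictScalars f).obj X :=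
  ModuleCat.ofHom (X := (ModuleCat.restrictScalars f).obj X)
    (Y := (ModuleCat.restrictScalars f).obj X)
    { toFun := fun x => (g t • (show X from x) : X)
      map_add' := fun x y => smul_add (g t) (show X from x) (show X from y)
      map_smul' := fun s x => by
        change g t • (f s • (show X from x)) = f s • (g t • (show X from x))
        rw [smul_smul, smul_smul, (h s t).eq] }

/-- The action of `t : T` on a complex of `E`-modules, as an endomorphism of the underlying
complex of `S`-modules. -/
def actComplex (t : T) (M : CochainComplex (ModuleCat.{u} E) ℤ) :
    ((ModuleCat.restrictScalars f).mapHomologicalComplex _).obj M ⟶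
      ((ModuleCat.restrictScalars f).mapHomologicalComplex _).obj M where
  f i := actHom f g h t (M.X i)
  comm' i j _ := by
    ext x
    exact (M.d i j).hom.map_smul (g t) x

/-- For a morphism `p : P ⟶ M` of complexes of `S`-modules, the morphism of complexes
`T → Hom*_S(P, M)`, `t ↦ (x ↦ t • p x)`, with `T` in degree zero. When `p` is a K-projective
resolution, the target computes `RHom_S(M, M)` and this is the multiplication map
`T → RHom_S(M, M)`. -/
def mulMap (M : CochainComplex (ModuleCat.{u} E) ℤ) (P : CochainComplex (ModuleCat.{u} S) ℤ)
    (p : P ⟶ ((ModuleCat.restrictScalars f).mapHomologicalComplex _).obj M) :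
    (HomologicalComplex.single AddCommGrpCat.{u} (ComplexShape.up ℤ) 0).obj
        (AddCommGrpCat.of T) ⟶
      CochainComplex.HomComplex P
        (((ModuleCat.restrictScalars f).mapHomologicalComplex _).obj M) :=
  HomologicalComplex.mkHomFromSingle
    (AddCommGrpCat.ofHom
      { toFun := fun t => CochainComplex.HomComplex.Cochain.ofHom (p ≫ actComplex f g h t M)
        map_zero' := by
          rw [← CochainComplex.HomComplex.Cochain.ofHom_zero]
          congr 1
          ext i x
          change g 0 • (show M.X i from p.f i x) = 0
          rw [map_zero, zero_smul]
        map_add' := fun t t' => by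
          rw [← CochainComplex.HomComplex.Cochain.ofHom_add]
          congr 1
          ext i x
          change g (t + t') • (show M.X i from p.f i x) =
            g t • (show M.X i from p.f i x) + g t' • (show M.X i from p.f i x)
          rw [map_add, add_smul] })
    (fun j _ => by
      ext t
      exact CochainComplex.HomComplex.δ_ofHom (p := j) (p ≫ actComplex f g h t M))

/-- The multiplication map `T → RHom_S(M, M)` is an isomorphism in the derived category, where
`RHom_S(M, M)` is computed by a K-projective resolution `P` of `M` over `S`. (Whether it is a
quasi-isomorphism depends neither on `P` nor on the bimodule structures it respects.) -/
def MulIsIso (M : CochainComplex (ModuleCat.{u} E) ℤ) : Prop :=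
  ∃ (P : CochainComplex (ModuleCat.{u} S) ℤ)
    (p : P ⟶ ((ModuleCat.restrictScalars f).mapHomologicalComplex _).obj M),
    P.IsKProjective ∧ QuasiIso p ∧ QuasiIso (mulMap f g h M P p)

end Multiplication

/-! ### Tilting complexes of bimodules -/

section Tilting

variable (k A : Type u) [CommRing k] [Ring A] [Algebra k A]

/-- Perfect as a complex of left modules and as a complex of right modules. -/
def IsBiperfect (M : CochainComplex (ModuleCat.{u} (Env k A)) ℤ) : Prop :=
  IsPerfect (((leftRes k A).mapHomologicalComplex _).obj M) ∧
  IsPerfect (((rightRes k A).mapHomologicalComplex _).obj M)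

/-- A (two-sided) tilting complex of `A`-bimodules: it is biperfect, the left multiplication
`A → RHom_A(M, M)` into the derived endomorphisms of `M` as a right module is an isomorphism,
and so is the right multiplication `A → RHom_{Aᵒᵖ}(M, M)` into the derived endomorphisms of
`M` as a left module. -/
structure IsTilting (M : CochainComplex (ModuleCat.{u} (Env k A)) ℤ) : Prop where
  biperfect : IsBiperfect k A M
  left_mul : MulIsIso (inr k A) (inl k A) (fun b a => (commute_inl_inr k A a b).symm) M
  right_mul : MulIsIso (inl k A) (inr k A) (fun a b => commute_inl_inr k A a b) M

end Tilting

/-! ### Localization -/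

section Localization

variable {R : Type u} [CommRing R] (m : Ideal R) [m.IsPrime]
  (Γ : Type u) [Ring Γ] [Algebra R Γ]

/-- `Γ_m`, an algebra over `R_m`. -/
abbrev LocAlg : Type u := Localization.AtPrime m ⊗[R] Γ

/-- The underlying `R`-module of a bimodule. -/
@[reducible] def bimodBase (M : ModuleCat.{u} (Env R Γ)) : Module R M :=
  Module.restrictScalars R (Env R Γ) M

attribute [local instance] bimodBase

lemma bimodBase_tower (M : ModuleCat.{u} (Env R Γ)) : IsScalarTower R (Env R Γ) M :=
  IsScalarTower.restrictScalars R (Env R Γ) M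

attribute [local instance] bimodBase_tower

/-- `M_m = R_m ⊗[R] M` -/
abbrev LocMod (M : ModuleCat.{u} (Env R Γ)) : Type u := Localization.AtPrime m ⊗[R] M

/-- `Γ ⊗ Γᵐᵒᵖ` acts on `R_m ⊗ M` through the second factor. -/
def envAct (M : ModuleCat.{u} (Env R Γ)) :
    Env R Γ →ₐ[R] Module.End (Localization.AtPrime m) (LocMod m Γ M) :=
  (Module.End.baseChangeHom R (Localization.AtPrime m) M).comp (Algebra.lsmul R R M)

lemma envAct_tmul (M : ModuleCat.{u} (Env R Γ)) (e : Env R Γ) (t : Localization.AtPrime m)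
    (x : M) : envAct m Γ M e (t ⊗ₜ x) = t ⊗ₜ (e • x) :=
  rfl

/-- The left action of `Γ_m` on `M_m`. -/
def locLeft (M : ModuleCat.{u} (Env R Γ)) :
    LocAlg m Γ →ₐ[Localization.AtPrime m]
      Module.End (Localization.AtPrime m) (LocMod m Γ M) :=
  Algebra.TensorProduct.lift (Algebra.ofId _ _)
    ((envAct m Γ M).comp Algebra.TensorProduct.includeLeft)
    (fun r _ => Algebra.commutes r _)

/-- The right action of `Γ_m` on `M_m`. -/
def locRight (M : ModuleCat.{u} (Env R Γ)) :
    (LocAlg m Γ)ᵐᵒᵖ →ₐ[Localization.AtPrime m]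
      Module.End (Localization.AtPrime m) (LocMod m Γ M) :=
  AlgHom.opComm (Algebra.TensorProduct.lift (Algebra.ofId _ _)
    (AlgHom.opComm.symm ((envAct m Γ M).comp Algebra.TensorProduct.includeRight))
    (fun r _ => Algebra.commutes r _))

lemma locLeft_tmul (M : ModuleCat.{u} (Env R Γ)) (r t : Localization.AtPrime m) (a : Γ) (x : M) :
    locLeft m Γ M (r ⊗ₜ a) (t ⊗ₜ x) = (r * t) ⊗ₜ (inl R Γ a • x) := by
  change r • envAct m Γ M (inl R Γ a) (t ⊗ₜ x) = _
  rw [envAct_tmul, smul_tmul', smul_eq_mul]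

lemma locRight_tmul (M : ModuleCat.{u} (Env R Γ)) (r t : Localization.AtPrime m) (b : Γ) (x : M) :
    locRight m Γ M (op (r ⊗ₜ b)) (t ⊗ₜ x) = (r * t) ⊗ₜ (inr R Γ (op b) • x) := by
  change envAct m Γ M (inr R Γ (op b)) (r • (t ⊗ₜ x)) = _
  rw [smul_tmul', smul_eq_mul, envAct_tmul]

lemma locLeft_locRight (M : ModuleCat.{u} (Env R Γ)) (a : LocAlg m Γ) (b : (LocAlg m Γ)ᵐᵒᵖ) :
    Commute (locLeft m Γ M a) (locRight m Γ M b) := by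
  induction b using MulOpposite.rec' with | _ b
  induction a using TensorProduct.induction_on with
  | zero => simp
  | add x y hx hy => simpa using hx.add_left hy
  | tmul r a =>
    induction b using TensorProduct.induction_on with
    | zero => simp
    | add x y hx hy => simpa using hx.add_right hy
    | tmul s b =>
      ext x
      simp only [Module.End.mul_apply, AlgebraTensorModule.curry_apply, curry_apply,
        LinearMap.coe_restrictScalars, locLeft_tmul,
        locRight_tmul, smul_smul, (commute_inl_inr R Γ a (op b)).eq]
      rw [mul_left_comm]

/-- The action of `Γ_m ⊗ Γ_mᵐᵒᵖ` on `M_m`, combining the two one-sided actions. -/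
def locAct (M : ModuleCat.{u} (Env R Γ)) :
    Env (Localization.AtPrime m) (LocAlg m Γ) →ₐ[Localization.AtPrime m]
      Module.End (Localization.AtPrime m) (LocMod m Γ M) :=
  Algebra.TensorProduct.lift (locLeft m Γ M) (locRight m Γ M) (locLeft_locRight m Γ M)

/-- `M_m` as a module over `Γ_m ⊗ Γ_mᵐᵒᵖ`, i.e. as a `Γ_m`-bimodule. -/
@[reducible] def locModule (M : ModuleCat.{u} (Env R Γ)) :
    Module (Env (Localization.AtPrime m) (LocAlg m Γ)) (LocMod m Γ M) :=
  Module.compHom (LocMod m Γ M) (locAct m Γ M).toRingHom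

/-- The localization `M_m` of a `Γ`-bimodule `M`, as a `Γ_m`-bimodule. -/
def locObj (M : ModuleCat.{u} (Env R Γ)) :
    ModuleCat.{u} (Env (Localization.AtPrime m) (LocAlg m Γ)) :=
  letI := locModule m Γ M
  ModuleCat.of _ (LocMod m Γ M)

/-- The localized action is `((r ⊗ a) ⊗ (s ⊗ b)) • (t ⊗ x) = r s t ⊗ a x b`. -/
lemma locAct_tmul (M : ModuleCat.{u} (Env R Γ)) (r s t : Localization.AtPrime m) (a b : Γ)
    (x : M) :
    locAct m Γ M ((r ⊗ₜ a) ⊗ₜ op (s ⊗ₜ b)) (t ⊗ₜ x) =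
      (r * (s * t)) ⊗ₜ (inl R Γ a • inr R Γ (op b) • x) := by
  simp only [locAct, Algebra.TensorProduct.lift_tmul, Module.End.mul_apply, locRight_tmul,
    locLeft_tmul]

/-- The localization `R_m ⊗ φ` of a homomorphism of bimodules, as an `R_m`-linear map. -/
def locLin {M N : ModuleCat.{u} (Env R Γ)} (φ : M ⟶ N) :
    LocMod m Γ M →ₗ[Localization.AtPrime m] LocMod m Γ N :=
  (φ.hom.restrictScalars R).baseChange (Localization.AtPrime m)

lemma locLin_locAct {M N : ModuleCat.{u} (Env R Γ)} (φ : M ⟶ N)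
    (e : Env (Localization.AtPrime m) (LocAlg m Γ)) (y : LocMod m Γ M) :
    locLin m Γ φ (locAct m Γ M e y) = locAct m Γ N e (locLin m Γ φ y) := by
  induction e using TensorProduct.induction_on with
  | zero => simp
  | add e e' he he' => simp only [map_add, LinearMap.add_apply, he, he']
  | tmul a b =>
    induction b using MulOpposite.rec' with | _ b
    induction a using TensorProduct.induction_on with
    | zero => simp
    | add e e' he he' => simp only [add_tmul, map_add, LinearMap.add_apply, he, he']
    | tmul r a =>
      induction b using TensorProduct.induction_on with
      | zero => simp
      | add e e' he he' =>
        rw [MulOpposite.op_add, tmul_add, map_add, map_add, LinearMap.add_apply, LinearMap.add_apply, map_add,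
          he, he']
      | tmul s b =>
        induction y using TensorProduct.induction_on with
        | zero => simp
        | add y y' hy hy' => simp only [map_add, hy, hy']
        | tmul t x =>
          rw [locAct_tmul]
          simp only [locLin, LinearMap.baseChange_tmul, LinearMap.coe_restrictScalars, map_smul]
          rw [locAct_tmul]

/-- Localization at `m`, as a functor from `Γ`-bimodules to `Γ_m`-bimodules. -/
def locFunctor :
    ModuleCat.{u} (Env R Γ) ⥤
      ModuleCat.{u} (Env (Localization.AtPrime m) (LocAlg m Γ)) where
  obj M := locObj m Γ M
  map {M N} φ :=
    ModuleCat.ofHom (X := locObj m Γ M) (Y := locObj m Γ N)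
      { toFun := locLin m Γ φ
        map_add' := fun y y' => (locLin m Γ φ).map_add y y'
        map_smul' := fun e y => locLin_locAct m Γ φ e y }
  map_id M := by
    ext y
    change locLin m Γ (𝟙 M) y = y
    exact LinearMap.congr_fun (LinearMap.baseChange_id (R := R)) y
  map_comp φ ψ := by
    ext y
    change locLin m Γ (φ ≫ ψ) y = locLin m Γ ψ (locLin m Γ φ y)
    exact LinearMap.congr_fun (LinearMap.baseChange_comp (A := Localization.AtPrime m)
      (φ.hom.restrictScalars R) (ψ.hom.restrictScalars R)) y

instance : (locFunctor m Γ).Additive where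
  map_add {M N φ ψ} := by
    ext y
    change locLin m Γ (φ + ψ) y = locLin m Γ φ y + locLin m Γ ψ y
    exact LinearMap.congr_fun (LinearMap.baseChange_add (A := Localization.AtPrime m)
      (φ.hom.restrictScalars R) (ψ.hom.restrictScalars R)) y

/-- The localization of a complex of `Γ`-bimodules. -/
def locComplex (M : CochainComplex (ModuleCat.{u} (Env R Γ)) ℤ) :
    CochainComplex (ModuleCat.{u} (Env (Localization.AtPrime m) (LocAlg m Γ))) ℤ :=
  ((locFunctor m Γ).mapHomologicalComplex _).obj M

end Localization

/-- A module regarded as a complex concentrated in degree zero. -/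
abbrev inDegreeZero {S : Type u} [Ring S] (X : ModuleCat.{u} S) :
    CochainComplex (ModuleCat.{u} S) ℤ :=
  (HomologicalComplex.single (ModuleCat.{u} S) (ComplexShape.up ℤ) 0).obj X

end TiltingBimod

end

/-!
Choose a bounded resolution `P` of `M` by finitely generated projective right modules. The left
multiplication map `Γ → RHom(M, M)` is an isomorphism if and only if the cochains in `Hom*(P, M)`
satisfy certain membership conditions: every cocycle of nonzero degree is a coboundary, every
cocycle of degree zero agrees with a multiplication up to a coboundary, and an element that acts by
a coboundary is zero. Each condition puts an element into an `R`-submodule, so it may be checked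
at every maximal ideal `m` up to multiplication by elements outside `m`. As `P` is bounded and
finitely presented in each degree, `Hom*(P, M)_m` consists of the cochains from `P` to `M_m`; by
adjunction these are the cochains from `P_m` to `M_m`, and `P_m` resolves `M_m`. So the conditions
at `m` follow from the tilting property of `M_m`.

In part (2), a finitely generated module that is projective at every `m` is projective, because a
section of a surjection exists globally if it exists at every `m` up to multiplication by elements
outside `m`. Induction on `n` along syzygies then shows that `M` is perfect on both sides.
-/

noncomputable section

namespace TiltingBimod

open CochainComplex CochainComplex.HomComplex

section LocalGlobal

variable {R : Type*} [CommRing R]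

lemma mem_of_forall_maximal {V : Type*} [AddCommGroup V] [Module R V] (U : Submodule R V) (z : V)
    (h : ∀ (m : Ideal R) [m.IsMaximal], ∃ a ∈ m.primeCompl, a • z ∈ U) : z ∈ U := by
  refine Submodule.mem_of_localization_maximal _
    (fun m _ => LocalizedModule.mkLinearMap m.primeCompl V) z U fun m _ => ?_
  obtain ⟨a, ha, haz⟩ := h m
  exact ⟨a • z, haz, ⟨a, ha⟩, IsLocalizedModule.mk'_cancel _ z ⟨a, ha⟩⟩

lemma exists_mem_forall_finset_of_forall {R : Type*} [CommMonoid R] (W : Submonoid R) {ι : Type*}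
    (s : Finset ι) {p : ι → R → Prop} (hp : ∀ i a b, p i b → p i (a * b))
    (h : ∀ i ∈ s, ∃ a ∈ W, p i a) : ∃ a ∈ W, ∀ i ∈ s, p i a := by
  choose! a ha hpa using h
  classical
  refine ⟨∏ i ∈ s, a i, prod_mem ha, fun i hi => ?_⟩
  rw [← Finset.prod_erase_mul s a hi]
  exact hp i _ _ (hpa i hi)

variable {S X Y Y' : Type*} [Ring S] [Algebra R S]
  [AddCommGroup X] [Module S X]
  [AddCommGroup Y] [Module S Y] [Module R Y] [IsScalarTower R S Y]
  [AddCommGroup Y'] [Module S Y'] [Module R Y'] [IsScalarTower R S Y']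
  (W : Submonoid R) (l : Y →ₗ[S] Y') [IsLocalizedModule W (l.restrictScalars R)]
include l

lemma exists_smul_eq_zero_of_map_eq_zero {y : Y} (hy : l y = 0) : ∃ a ∈ W, a • y = 0 := by
  obtain ⟨a, ha⟩ := (IsLocalizedModule.eq_zero_iff W (l.restrictScalars R)).1 hy
  exact ⟨a, a.2, ha⟩

lemma exists_smul_eq_zero_of_comp_eq_zero [Module.Finite S X] (σ : X →ₗ[S] Y)
    (h : l ∘ₗ σ = 0) : ∃ a ∈ W, a • σ = 0 := by
  obtain ⟨s, hs⟩ := Module.finite_def.1 ‹Module.Finite S X›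
  obtain ⟨a, ha, has⟩ := exists_mem_forall_finset_of_forall W s (p := fun x a => a • σ x = 0)
    (fun x a b hb => by rw [mul_smul, hb, smul_zero])
    fun x _ => exists_smul_eq_zero_of_map_eq_zero W l (LinearMap.congr_fun h x)
  exact ⟨a, ha, LinearMap.ext_on hs fun x hx => has x hx⟩

lemma exists_lift_of_fin (n : ℕ) (ψ : (Fin n → S) →ₗ[S] Y') :
    ∃ (σ : (Fin n → S) →ₗ[S] Y), ∃ a ∈ W, l ∘ₗ σ = a • ψ := by
  obtain ⟨a, ha⟩ := IsLocalizedModule.exist_integer_multiples_of_finite W (l.restrictScalars R)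
    fun i => ψ (Pi.basisFun S (Fin n) i)
  choose y hy using ha
  refine ⟨(Pi.basisFun S (Fin n)).constr ℕ y, a, a.2, (Pi.basisFun S (Fin n)).ext fun i => ?_⟩
  rw [LinearMap.comp_apply, Module.Basis.constr_basis]
  exact hy i

lemma exists_lift_of_finitePresentation [Module.FinitePresentation S X]
    (ψ : X →ₗ[S] Y') : ∃ (σ : X →ₗ[S] Y), ∃ a ∈ W, l ∘ₗ σ = a • ψ := by
  obtain ⟨n, m, π, κ, hπ, hκ⟩ := Module.FinitePresentation.exists_fin' S X
  obtain ⟨σ, a, ha, hσ⟩ := exists_lift_of_fin W l n (ψ ∘ₗ π)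
  obtain ⟨b, hb, hbσ⟩ := exists_smul_eq_zero_of_comp_eq_zero W l (σ ∘ₗ κ) (by
    rw [← LinearMap.comp_assoc, hσ, LinearMap.smul_comp, LinearMap.comp_assoc,
      hκ.linearMap_comp_eq_zero, LinearMap.comp_zero, smul_zero])
  have hker : LinearMap.ker π ≤ LinearMap.ker (b • σ) := by
    rw [hκ.linearMap_ker_eq]
    rintro _ ⟨x, rfl⟩
    exact LinearMap.congr_fun hbσ x
  refine ⟨Submodule.liftQ _ _ hker ∘ₗ (LinearMap.quotKerEquivOfSurjective π hπ).symm,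
    b * a, mul_mem hb ha, ?_⟩
  refine (LinearMap.cancel_right hπ).1 (LinearMap.ext fun x => ?_)
  have hx : b • l (σ x) = b • a • ψ (π x) := congrArg (b • ·) (LinearMap.congr_fun hσ x)
  simpa [mul_smul, LinearMap.map_smul_of_tower] using hx

end LocalGlobal

/-- The family `β` of morphisms `P ⟶ N` identifies `T` with the cohomology of the complex
`Hom*(P, N)`, which is therefore concentrated in degree zero. -/
structure RepresentsHom {C : Type*} [Category* C] [Preadditive C] {P N : CochainComplex C ℤ}
    {T : Type*} [AddCommGroup T] (β : T →+ (P ⟶ N)) : Prop where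
  exact : ∀ n : ℤ, n ≠ 0 → ∀ z : Cochain P N n, δ n (n + 1) z = 0 →
    ∃ w : Cochain P N (n - 1), δ (n - 1) n w = z
  surj : ∀ u : P ⟶ N, ∃ t, ∃ w : Cochain P N (-1),
    Cochain.ofHom u = Cochain.ofHom (β t) + δ (-1) 0 w
  inj : ∀ t, (∃ w : Cochain P N (-1), Cochain.ofHom (β t) = δ (-1) 0 w) → t = 0

section Cohomology

variable {C : Type*} [Category* C] [Preadditive C] {P N : CochainComplex C ℤ}

lemma subsingleton_cohomologyClass_iff (n : ℤ) :
    Subsingleton (CohomologyClass P N n) ↔ ∀ z : Cochain P N n, δ n (n + 1) z = 0 →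
      ∃ w : Cochain P N (n - 1), δ (n - 1) n w = z := by
  have mk_eq_zero_iff (z : Cocycle P N n) : CohomologyClass.mk z = 0 ↔
      ∃ w : Cochain P N (n - 1), δ (n - 1) n w = z := by
    rw [CohomologyClass.mk_eq_zero_iff, mem_coboundaries_iff _ (n - 1) (by simp)]
  refine ⟨fun _ z hz => (mk_eq_zero_iff (Cocycle.mk z (n + 1) rfl hz)).1 (Subsingleton.elim _ _),
    fun h => subsingleton_of_forall_eq 0 fun x => ?_⟩
  obtain ⟨z, rfl⟩ := x.mk_surjective
  exact (mk_eq_zero_iff z).2 (h z (z.δ_eq_zero _))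

lemma bijective_comp_iff {T H : Type*} [AddCommGroup T] [AddCommGroup H] (β : T →+ (P ⟶ N))
    (κ : (P ⟶ N) →+ H) (hκ : Function.Surjective κ)
    (hκ₀ : ∀ u, κ u = 0 ↔ ∃ w : Cochain P N (-1), Cochain.ofHom u = δ (-1) 0 w) :
    Function.Bijective (κ.comp β) ↔
      (∀ t, (∃ w : Cochain P N (-1), Cochain.ofHom (β t) = δ (-1) 0 w) → t = 0) ∧
      ∀ u : P ⟶ N, ∃ t, ∃ w : Cochain P N (-1),
        Cochain.ofHom u = Cochain.ofHom (β t) + δ (-1) 0 w := by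
  refine and_congr ?_ ((hκ.forall).trans (forall_congr' fun u => exists_congr fun t => ?_))
  · simp only [injective_iff_map_eq_zero, AddMonoidHom.comp_apply, hκ₀]
  · rw [eq_comm, AddMonoidHom.comp_apply, ← sub_eq_zero, ← map_sub, hκ₀]
    simp only [Cochain.ofHom_sub, sub_eq_iff_eq_add']

end Cohomology

section HomComplexHomology

variable {C : Type*} [Category.{u} C] [Preadditive C] {P N : CochainComplex C ℤ}

lemma exactAt_homComplex_iff (n : ℤ) :
    (HomComplex P N).ExactAt n ↔ ∀ z : Cochain P N n, δ n (n + 1) z = 0 →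
      ∃ w : Cochain P N (n - 1), δ (n - 1) n w = z := by
  rw [HomologicalComplex.exactAt_iff' _ (n - 1) n (n + 1) (by simp) (by simp),
    ShortComplex.ab_exact_iff]
  rfl

/-- The class of a morphism of complexes in the zeroth cohomology of the complex `Hom*(P, N)`. -/
def homClass (P N : CochainComplex C ℤ) : (P ⟶ N) →+ CohomologyClass P N 0 :=
  (CohomologyClass.mkAddMonoidHom P N 0).comp (Cocycle.equivHom P N).toAddMonoidHom

lemma homClass_surjective : Function.Surjective (homClass P N) :=
  (CohomologyClass.mk_surjective).comp (Cocycle.equivHom P N).surjective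

lemma homClass_eq_zero_iff (u : P ⟶ N) :
    homClass P N u = 0 ↔ ∃ w : Cochain P N (-1), Cochain.ofHom u = δ (-1) 0 w := by
  refine (CohomologyClass.mk_eq_zero_iff (Cocycle.ofHom u)).trans ?_
  rw [mem_coboundaries_iff _ (-1) (by simp)]
  exact exists_congr fun w => eq_comm

variable {T : Type u} [AddCommGroup T]

lemma quasiIsoAt_zero_iff_bijective
    (φ : (HomologicalComplex.single AddCommGrpCat.{u} (ComplexShape.up ℤ) 0).obj
        (AddCommGrpCat.of T) ⟶ HomComplex P N) (β : T →+ (P ⟶ N))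
    (hφ : φ.f 0 = (HomologicalComplex.singleObjXSelf (ComplexShape.up ℤ) 0
      (AddCommGrpCat.of T)).hom ≫ AddCommGrpCat.ofHom
        ((Cocycle.toCochainAddMonoidHom P N 0).comp
          ((Cocycle.equivHom P N).toAddMonoidHom.comp β))) :
    QuasiIsoAt φ 0 ↔ Function.Bijective ((homClass P N).comp β) := by
  let e := HomologicalComplex.singleObjXSelf (ComplexShape.up ℤ) 0 (AddCommGrpCat.of T)
  let h₁ : (((HomologicalComplex.single AddCommGrpCat.{u} (ComplexShape.up ℤ) 0).obj
        (AddCommGrpCat.of T)).sc 0).LeftHomologyData :=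
    ShortComplex.LeftHomologyData.ofZeros _ rfl rfl
  let φK : h₁.K ⟶ (leftHomologyData P N 0).K :=
    e.hom ≫ AddCommGrpCat.ofHom ((Cocycle.equivHom P N).toAddMonoidHom.comp β)
  let φH : h₁.H ⟶ (leftHomologyData P N 0).H :=
    e.hom ≫ AddCommGrpCat.ofHom ((homClass P N).comp β)
  have commi : φK ≫ (leftHomologyData P N 0).i = h₁.i ≫
      ((HomologicalComplex.shortComplexFunctor AddCommGrpCat.{u} (ComplexShape.up ℤ) 0).map φ).τ₂ :=
    ((Category.id_comp (φ.f 0)).trans hφ).symm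
  let γ : ShortComplex.LeftHomologyMapData
      ((HomologicalComplex.shortComplexFunctor AddCommGrpCat.{u} (ComplexShape.up ℤ) 0).map φ)
        h₁ (leftHomologyData P N 0) :=
    { φK := φK
      φH := φH
      commi := commi
      commf' := by
        rw [← cancel_mono (leftHomologyData P N 0).i, Category.assoc, commi, ← Category.assoc,
          h₁.f'_i, Category.assoc, (leftHomologyData P N 0).f'_i]
        exact ((HomologicalComplex.shortComplexFunctor AddCommGrpCat.{u}
          (ComplexShape.up ℤ) 0).map φ).comm₁₂.symm
      commπ := Category.id_comp φH }
  rw [quasiIsoAt_iff, γ.quasiIso_iff]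
  exact (isIso_comp_left_iff e.hom _).trans
    (ConcreteCategory.isIso_iff_bijective (AddCommGrpCat.ofHom ((homClass P N).comp β)))

lemma quasiIso_iff_representsHom
    (φ : (HomologicalComplex.single AddCommGrpCat.{u} (ComplexShape.up ℤ) 0).obj
        (AddCommGrpCat.of T) ⟶ HomComplex P N) (β : T →+ (P ⟶ N))
    (hφ : φ.f 0 = (HomologicalComplex.singleObjXSelf (ComplexShape.up ℤ) 0
      (AddCommGrpCat.of T)).hom ≫ AddCommGrpCat.ofHom
        ((Cocycle.toCochainAddMonoidHom P N 0).comp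
          ((Cocycle.equivHom P N).toAddMonoidHom.comp β))) :
    QuasiIso φ ↔ RepresentsHom β := by
  have quasiIsoAt_iff_exact (n : ℤ) (hn : n ≠ 0) : QuasiIsoAt φ n ↔
      ∀ z : Cochain P N n, δ n (n + 1) z = 0 → ∃ w : Cochain P N (n - 1), δ (n - 1) n w = z := by
    rw [quasiIsoAt_iff_exactAt _ _ (HomologicalComplex.exactAt_single_obj _ _ _ _ hn),
      exactAt_homComplex_iff]
  have quasiIsoAt_zero_iff := (quasiIsoAt_zero_iff_bijective φ β hφ).trans
    (bijective_comp_iff β _ homClass_surjective homClass_eq_zero_iff)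
  rw [quasiIso_iff]
  refine ⟨fun h => ?_, fun h n => ?_⟩
  · obtain ⟨inj, surj⟩ := quasiIsoAt_zero_iff.1 (h 0)
    exact ⟨fun n hn => (quasiIsoAt_iff_exact n hn).1 (h n), surj, inj⟩
  · obtain rfl | hn := eq_or_ne n 0
    · exact quasiIsoAt_zero_iff.2 ⟨h.inj, h.surj⟩
    · exact (quasiIsoAt_iff_exact n hn).2 (h.exact n hn)

end HomComplexHomology

section Multiplication

variable {E S T : Type u} [Ring E] [Ring S] [Ring T]
  (f : S →+* E) (g : T →+* E) (h : ∀ s t, Commute (f s) (g t))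

/-- The action of `T` on a complex of `E`-modules by endomorphisms of the underlying complex of
`S`-modules. -/
def actionHom (M : CochainComplex (ModuleCat.{u} E) ℤ) :
    T →+ (((ModuleCat.restrictScalars f).mapHomologicalComplex (.up ℤ)).obj M ⟶
      ((ModuleCat.restrictScalars f).mapHomologicalComplex (.up ℤ)).obj M) :=
  AddMonoidHom.mk' (fun t => actComplex f g h t M) fun t t' => by
    ext i x
    change g (t + t') • (show M.X i from x) = g t • (show M.X i from x) + g t' • (show M.X i from x)
    rw [map_add, add_smul]

lemma quasiIso_mulMap_iff (M : CochainComplex (ModuleCat.{u} E) ℤ)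
    (P : CochainComplex (ModuleCat.{u} S) ℤ)
    (p : P ⟶ ((ModuleCat.restrictScalars f).mapHomologicalComplex _).obj M) :
    QuasiIso (mulMap f g h M P p) ↔
      RepresentsHom ((Preadditive.leftComp _ p).comp (actionHom f g h M)) :=
  quasiIso_iff_representsHom _ _ (HomologicalComplex.mkHomFromSingle_f _ _)

end Multiplication

section KProjective

variable {C : Type*} [Category* C] [Abelian C] [HasDerivedCategory C]
  {P P' N N' : CochainComplex C ℤ} [P.IsKProjective] [P'.IsKProjective]

open DerivedCategory

lemma bijective_homCongr_Qh_map :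
    Function.Bijective fun u : (HomotopyCategory.quotient C (.up ℤ)).obj P ⟶
      (HomotopyCategory.quotient C (.up ℤ)).obj N =>
        ((quotientCompQhIso C).app P).homCongr ((quotientCompQhIso C).app N) (Qh.map u) :=
  (Iso.homCongr _ _).bijective.comp (IsKProjective.Qh_map_bijective P _)

lemma Q_map_surjective : Function.Surjective (Q.map : (P ⟶ N) → (Q.obj P ⟶ Q.obj N)) := by
  have h := bijective_homCongr_Qh_map (P := P) (N := N).surjective.comp
    (HomotopyCategory.quotient C (.up ℤ)).map_surjective
  convert! h using 1
  ext u
  exact (NatIso.naturality_1 (quotientCompQhIso C) u).symm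

lemma Q_map_eq_zero_iff (u : P ⟶ N) :
    Q.map u = 0 ↔ ∃ w : Cochain P N (-1), Cochain.ofHom u = δ (-1) 0 w := by
  have h : Q.map u = 0 ↔ (HomotopyCategory.quotient C (.up ℤ)).map u = 0 := by
    rw [← (bijective_homCongr_Qh_map (P := P) (N := N)).injective.eq_iff]
    simp [Iso.homCongr]
  rw [h, HomotopyCategory.quotient_map_eq_zero_iff,
    (Cochain.equivHomotopy u 0).nonempty_congr, nonempty_subtype]
  simp only [Cochain.ofHom_zero, add_zero]

lemma subsingleton_cohomologyClass_iff_shift (n : ℤ) :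
    Subsingleton (CohomologyClass P N n) ↔ Subsingleton (Q.obj P ⟶ (Q.obj N)⟦n⟧) :=
  (Equiv.ofBijective _ (bijective_homCongr_Qh_map.comp
    (CohomologyClass.toHom_bijective P N n))).subsingleton_congr.trans
  (((Q.commShiftIso n).app N).homToEquiv).subsingleton_congr

lemma representsHom_iff_Q {T : Type*} [AddCommGroup T] (β : T →+ (P ⟶ N)) :
    RepresentsHom β ↔ (∀ n : ℤ, n ≠ 0 → Subsingleton (Q.obj P ⟶ (Q.obj N)⟦n⟧)) ∧
      Function.Bijective (Q.mapAddHom.comp β) := by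
  rw [bijective_comp_iff β Q.mapAddHom Q_map_surjective Q_map_eq_zero_iff]
  simp only [← subsingleton_cohomologyClass_iff_shift, subsingleton_cohomologyClass_iff]
  exact ⟨fun h => ⟨h.exact, h.inj, h.surj⟩, fun h => ⟨h.1, h.2.2, h.2.1⟩⟩

lemma RepresentsHom.of_iso_Q {T : Type*} [AddCommGroup T] {β : T →+ (P ⟶ N)}
    (hβ : RepresentsHom β) (β' : T →+ (P' ⟶ N')) (p : Q.obj P ≅ Q.obj P') (e : Q.obj N ≅ Q.obj N')
    (h : ∀ t, Q.map (β t) ≫ e.hom = p.hom ≫ Q.map (β' t)) : RepresentsHom β' := by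
  rw [representsHom_iff_Q] at hβ ⊢
  refine ⟨fun n hn => ?_, ?_⟩
  · have := hβ.1 n hn
    exact (p.homCongr ((CategoryTheory.shiftFunctor _ n).mapIso e)).symm.subsingleton
  · convert! (p.homCongr e).bijective.comp hβ.2 using 1
    ext t
    simp [h]

end KProjective

section LinearCategory

variable {R : Type*} [CommRing R] {C : Type*} [Category* C] [Preadditive C] [Linear R C]
  {P N : CochainComplex C ℤ} {T : Type*} [AddCommGroup T] [Module R T]

/-- The version of `RepresentsHom` in which every identity is only required to hold up to
multiplication by an element of `W`. -/
structure RepresentsHomAt (W : Submonoid R) (β : T →ₗ[R] (P ⟶ N)) : Prop where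
  exact : ∀ n : ℤ, n ≠ 0 → ∀ z : Cochain P N n, δ n (n + 1) z = 0 →
    ∃ a ∈ W, ∃ w : Cochain P N (n - 1), δ (n - 1) n w = a • z
  surj : ∀ u : P ⟶ N, ∃ a ∈ W, ∃ t, ∃ w : Cochain P N (-1),
    a • Cochain.ofHom u = Cochain.ofHom (β t) + δ (-1) 0 w
  inj : ∀ t, (∃ w : Cochain P N (-1), Cochain.ofHom (β t) = δ (-1) 0 w) → ∃ a ∈ W, a • t = 0

lemma ofHom_smul (r : R) (u : P ⟶ N) : Cochain.ofHom (r • u) = r • Cochain.ofHom u := by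
  ext p
  simp

theorem RepresentsHom.of_forall_maximal (β : T →ₗ[R] (P ⟶ N))
    (H : ∀ (m : Ideal R) [m.IsMaximal], RepresentsHomAt m.primeCompl β) :
    RepresentsHom β.toAddMonoidHom where
  exact n hn z hz := by
    refine mem_of_forall_maximal (LinearMap.range (δ_hom R P N (n - 1) n)) z fun m _ => ?_
    exact (H m).exact n hn z hz
  surj u := by
    let B : T →ₗ[R] Cochain P N 0 :=
      { toFun := fun t => Cochain.ofHom (β t)
        map_add' := fun t t' => by rw [map_add, Cochain.ofHom_add]
        map_smul' := fun r t => by rw [map_smul, ofHom_smul, RingHom.id_apply] }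
    obtain ⟨⟨t, w⟩, htw⟩ := mem_of_forall_maximal
      (LinearMap.range (B.coprod (δ_hom R P N (-1) 0))) (Cochain.ofHom u) fun m _ => by
        obtain ⟨a, ha, t, w, htw⟩ := (H m).surj u
        exact ⟨a, ha, (t, w), htw.symm⟩
    exact ⟨t, w, htw.symm⟩
  inj t ht := (Submodule.mem_bot R).1 <| mem_of_forall_maximal ⊥ t fun m _ => by
    simpa only [Submodule.mem_bot] using (H m).inj t ht

end LinearCategory

section Linear

variable {R S : Type u} [CommRing R] [Ring S] [Algebra R S]

/-- The underlying `R`-module of a module over an `R`-algebra. -/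
@[reducible] def algBase (X : ModuleCat.{u} S) : Module R X :=
  Module.restrictScalars R S X

attribute [local instance] algBase

lemma algBase_tower (X : ModuleCat.{u} S) : IsScalarTower R S X :=
  IsScalarTower.restrictScalars R S X

attribute [local instance] algBase_tower

variable (R S) in
/-- Modules over an `R`-algebra form an `R`-linear category. -/
@[reducible] def linearModuleCat : Linear R (ModuleCat.{u} S) where
  homModule _ _ := inferInstance

attribute [local instance] linearModuleCat

/-- `l` exhibits `Y` as the localization of `X` at `W`. -/
abbrev IsLocalizationHom {X Y : ModuleCat.{u} S} (W : Submonoid R) (l : X ⟶ Y) : Prop :=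
  IsLocalizedModule W (l.hom.restrictScalars R)

/-- A complex that vanishes outside a finite interval of degrees. -/
def IsBounded {C : Type*} [Category* C] [Preadditive C] (P : CochainComplex C ℤ) : Prop :=
  ∃ a b : ℤ, ∀ i, i < a ∨ b < i → Limits.IsZero (P.X i)

variable {P N N' : CochainComplex (ModuleCat.{u} S) ℤ} (W : Submonoid R) {l : N ⟶ N'}
  (hP : IsBounded P) (hl : ∀ i, IsLocalizationHom W (l.f i)) {n : ℤ}

include hP hl

lemma cochain_exists_smul_eq_zero [∀ i, Module.Finite S (P.X i)] (σ : Cochain P N n)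
    (h : σ.comp (Cochain.ofHom l) (add_zero n) = 0) : ∃ a ∈ W, a • σ = 0 := by
  obtain ⟨c, d, hcd⟩ := hP
  obtain ⟨a, ha, haσ⟩ := exists_mem_forall_finset_of_forall W (Finset.Icc c d)
    (p := fun p a => a • σ.v p (p + n) rfl = 0)
    (fun p a b hb => by rw [mul_smul, hb, smul_zero]) fun p _ => by
      have := hl (p + n)
      obtain ⟨a, ha, h₀⟩ := exists_smul_eq_zero_of_comp_eq_zero W (l.f (p + n)).hom
        (σ.v p (p + n) rfl).hom
        (by simpa [ModuleCat.hom_ext_iff] using Cochain.congr_v h p (p + n) rfl)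
      exact ⟨a, ha, ModuleCat.hom_ext h₀⟩
  refine ⟨a, ha, Cochain.ext _ _ fun p q hpq => ?_⟩
  subst hpq
  by_cases hp : p ∈ Finset.Icc c d
  · exact haσ p hp
  · exact (hcd p (by grind)).eq_of_src _ _

lemma cochain_exists_lift [∀ i, Module.FinitePresentation S (P.X i)] (ψ : Cochain P N' n) :
    ∃ σ : Cochain P N n, ∃ a ∈ W, σ.comp (Cochain.ofHom l) (add_zero n) = a • ψ := by
  obtain ⟨c, d, hcd⟩ := hP
  obtain ⟨a, ha, haψ⟩ := exists_mem_forall_finset_of_forall W (Finset.Icc c d)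
    (p := fun p a => ∃ σ : P.X p ⟶ N.X (p + n), σ ≫ l.f (p + n) = a • ψ.v p (p + n) rfl)
    (fun p a b ⟨σ, hσ⟩ => ⟨a • σ, by rw [Linear.smul_comp, hσ, mul_smul]⟩) fun p _ => by
      have := hl (p + n)
      obtain ⟨σ, a, ha, hσ⟩ := exists_lift_of_finitePresentation W (l.f (p + n)).hom
        (ψ.v p (p + n) rfl).hom
      exact ⟨a, ha, ModuleCat.ofHom σ, ModuleCat.hom_ext hσ⟩
  choose! σ hσ using haψ
  refine ⟨Cochain.mk fun p q hpq => σ p ≫ eqToHom (by rw [hpq]), a, ha,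
    Cochain.ext _ _ fun p q hpq => ?_⟩
  subst hpq
  by_cases hp : p ∈ Finset.Icc c d
  · simpa using hσ p hp
  · exact (hcd p (by grind)).eq_of_src _ _

theorem RepresentsHomAt.of_isLocalizationHom [∀ i, Module.FinitePresentation S (P.X i)]
    {T T' : Type*} [AddCommGroup T] [Module R T] [AddCommGroup T'] [Module R T']
    (τ : T →ₗ[R] T') [IsLocalizedModule W τ] (β : T →ₗ[R] (P ⟶ N)) (β' : T' →ₗ[R] (P ⟶ N'))
    (hβ' : RepresentsHom β'.toAddMonoidHom) (hβ : ∀ t, β t ≫ l = β' (τ t)) :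
    RepresentsHomAt W β where
  exact n hn z hz := by
    obtain ⟨w', hw'⟩ := hβ'.exact n hn (z.comp (Cochain.ofHom l) (add_zero n))
      (by rw [δ_comp_ofHom, hz, Cochain.zero_comp])
    obtain ⟨w, a, ha, hw⟩ := cochain_exists_lift W hP hl w'
    obtain ⟨b, hb, h₀⟩ := cochain_exists_smul_eq_zero W hP hl (δ (n - 1) n w - a • z) (by
      rw [Cochain.sub_comp, ← δ_comp_ofHom, hw, δ_smul, hw', Cochain.smul_comp, sub_self])
    rw [smul_sub, sub_eq_zero] at h₀
    exact ⟨b * a, mul_mem hb ha, b • w, by rw [δ_smul, h₀, mul_smul]⟩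
  surj u := by
    obtain ⟨t', w', hw'⟩ := hβ'.surj (u ≫ l)
    obtain ⟨w, a, ha, hw⟩ := cochain_exists_lift W hP hl w'
    obtain ⟨⟨t, c⟩, ht : c • t' = τ t⟩ := IsLocalizedModule.surj W τ t'
    have hβt : (Cochain.ofHom (β t)).comp (Cochain.ofHom l) (add_zero 0) =
        (c : R) • Cochain.ofHom (β' t') := by
      rw [← Cochain.ofHom_comp, hβ, ← ht, Submonoid.smul_def, map_smul, ofHom_smul]
    obtain ⟨b, hb, h₀⟩ := cochain_exists_smul_eq_zero W hP hl
      ((c * a : R) • Cochain.ofHom u - (a • Cochain.ofHom (β t) + (c : R) • δ (-1) 0 w)) (by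
        rw [Cochain.sub_comp, Cochain.add_comp, Cochain.smul_comp, Cochain.smul_comp,
          Cochain.smul_comp, hβt, ← δ_comp_ofHom, hw, δ_smul, ← Cochain.ofHom_comp,
          show Cochain.ofHom (u ≫ l) = _ from hw']
        simp only [LinearMap.toAddMonoidHom_coe]
        module)
    rw [smul_sub, sub_eq_zero] at h₀
    refine ⟨b * (c * a), mul_mem hb (mul_mem c.2 ha), (b * a) • t, (b * c : R) • w, ?_⟩
    rw [mul_smul, h₀, map_smul, ofHom_smul, δ_smul]
    module
  inj t := by
    rintro ⟨w, hw⟩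
    have hτt : τ t = 0 := hβ'.inj _ ⟨w.comp (Cochain.ofHom l) (add_zero _), by
      rw [δ_comp_ofHom, ← hw, ← Cochain.ofHom_comp, hβ, LinearMap.toAddMonoidHom_coe]⟩
    obtain ⟨a, ha⟩ := (IsLocalizedModule.eq_zero_iff W τ).1 hτt
    exact ⟨a, a.2, ha⟩

end Linear

section LocalizationAlgebra

variable {R S S' : Type*} [CommRing R] [Ring S] [Ring S'] [Algebra R S] [Algebra R S']
  (W : Submonoid R) (φ : S →ₐ[R] S') [IsLocalizedModule W φ.toLinearMap]

include W φ

lemma isUnit_algebraMap_of_mem {a : R} (ha : a ∈ W) : IsUnit (algebraMap R S' a) := by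
  have h := (Module.End.isUnit_iff _).1 (IsLocalizedModule.map_units φ.toLinearMap ⟨a, ha⟩)
  obtain ⟨s, hs : a • s = 1⟩ := h.surjective 1
  rw [Algebra.smul_def] at hs
  exact ⟨⟨algebraMap R S' a, s, hs, by rw [← Algebra.commutes, hs]⟩, rfl⟩

lemma exists_smul_eq_map (s' : S') : ∃ a ∈ W, ∃ s, a • s' = φ s := by
  obtain ⟨⟨s, a⟩, h⟩ := IsLocalizedModule.surj W φ.toLinearMap s'
  exact ⟨a, a.2, s, h⟩

lemma exists_algHom_comp_eq {B : Type*} [Ring B] [Algebra R B] (ψ : S →ₐ[R] B)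
    (hψ : ∀ a ∈ W, IsUnit (algebraMap R B a)) : ∃ χ : S' →ₐ[R] B, χ.comp φ = ψ := by
  have hψ' (a : W) : IsUnit (algebraMap R (Module.End R B) a) := by
    have := (hψ a a.2).map (Algebra.lmul R B)
    rwa [AlgHom.commutes] at this
  let χ : S' →ₗ[R] B := IsLocalizedModule.lift W φ.toLinearMap ψ.toLinearMap hψ'
  have hχ (s : S) : χ (φ s) = ψ s := IsLocalizedModule.lift_apply W φ.toLinearMap _ hψ' s
  refine ⟨AlgHom.ofLinearMap χ (by rw [← map_one φ, hχ, map_one]) fun x y => ?_,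
    AlgHom.ext hχ⟩
  obtain ⟨a, ha, s, hs⟩ := exists_smul_eq_map W φ x
  obtain ⟨b, hb, t, ht⟩ := exists_smul_eq_map W φ y
  have hab : (a * b) • (x * y) = φ (s * t) := by
    rw [map_mul, ← hs, ← ht, smul_mul_smul_comm]
  refine ((Module.End.isUnit_iff _).1 (hψ' ⟨a * b, mul_mem ha hb⟩)).injective ?_
  change (a * b) • χ (x * y) = (a * b) • (χ x * χ y)
  rw [← map_smul, hab, hχ, map_mul, ← smul_mul_smul_comm, ← map_smul, ← map_smul, hs, ht, hχ, hχ]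

lemma map_smul_of_map_smul {Y Z : Type*} [AddCommGroup Y] [AddCommGroup Z] [Module S' Y]
    [Module S' Z] (g : Y →+ Z) (hg : ∀ s y, g (φ s • y) = φ s • g y) (s' : S') (y : Y) :
    g (s' • y) = s' • g y := by
  obtain ⟨a, ha, s, hs⟩ := exists_smul_eq_map W φ s'
  rw [Algebra.smul_def] at hs
  refine (isUnit_algebraMap_of_mem W φ ha).smul_left_cancel.1 ?_
  rw [← AlgHom.commutes φ] at hs ⊢
  rw [← hg, smul_smul, smul_smul, hs, hg]

end LocalizationAlgebra

lemma exists_linearMap_comp_eq {R S X Y Z : Type*} [CommRing R] [Ring S] [Algebra R S]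
    [AddCommGroup X] [Module R X] [Module S X] [IsScalarTower R S X]
    [AddCommGroup Y] [Module R Y] [Module S Y] [IsScalarTower R S Y]
    [AddCommGroup Z] [Module R Z] [Module S Z] [IsScalarTower R S Z]
    (W : Submonoid R) (l : X →ₗ[S] Y) [IsLocalizedModule W (l.restrictScalars R)]
    (hZ : ∀ a : W, IsUnit (algebraMap R (Module.End R Z) a)) (f : X →ₗ[S] Z) :
    ∃ g : Y →ₗ[S] Z, g ∘ₗ l = f := by
  let g := IsLocalizedModule.lift W (l.restrictScalars R) (f.restrictScalars R) hZ
  have hg (x : X) : g (l x) = f x := IsLocalizedModule.lift_apply W (l.restrictScalars R) _ hZ x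
  have hgs (s : S) : g ∘ₗ Algebra.lsmul R R Y s = Algebra.lsmul R R Z s ∘ₗ g := by
    refine IsLocalizedModule.ext W (l.restrictScalars R) hZ (LinearMap.ext fun x => ?_)
    change g (s • l x) = s • g (l x)
    rw [← map_smul, hg, hg, map_smul]
  exact ⟨{ g with map_smul' := fun s => LinearMap.congr_fun (hgs s) }, LinearMap.ext hg⟩

section LocalizationFunctor

variable {R S S' : Type u} [CommRing R] [Ring S] [Ring S'] [Algebra R S] [Algebra R S']
  (W : Submonoid R) (φ : S →ₐ[R] S') [IsLocalizedModule W φ.toLinearMap]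

attribute [local instance] algBase algBase_tower linearModuleCat

/-- Restriction of scalars along a homomorphism of `R`-algebras. -/
abbrev algRes : ModuleCat.{u} S' ⥤ ModuleCat.{u} S :=
  ModuleCat.restrictScalars (φ : S →+* S')

include W in
lemma full_algRes : (algRes φ).Full where
  map_surjective {Y Z} g := ⟨ModuleCat.ofHom
    { g.hom.toAddMonoidHom with
      map_smul' := map_smul_of_map_smul W φ (Y := Y) (Z := Z) g.hom.toAddMonoidHom
        g.hom.map_smul }, rfl⟩

lemma isUnit_algebraMap_end_algRes (Y : ModuleCat.{u} S') (a : W) :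
    IsUnit (algebraMap R (Module.End R ((algRes φ).obj Y)) a) := by
  have hφa : IsUnit (algebraMap R S' a) := isUnit_algebraMap_of_mem W φ a.2
  refine (Module.End.isUnit_iff _).2 ?_
  convert! MulAction.bijective (β := Y) hφa.unit using 1
  ext y
  change φ (algebraMap R S a) • (show Y from y) = algebraMap R S' a • (show Y from y)
  rw [AlgHom.commutes]

lemma exists_isLocalizationHom (X : ModuleCat.{u} S) :
    ∃ (Y : ModuleCat.{u} S') (l : X ⟶ (algRes φ).obj Y), IsLocalizationHom W l := by
  let mk : X →ₗ[R] Localization W ⊗[R] X := TensorProduct.mk R (Localization W) X 1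
  obtain ⟨χ, hχ⟩ := exists_algHom_comp_eq W φ (B := Module.End R (Localization W ⊗[R] X))
    ((Module.End.lTensorAlgHom R X (Localization W)).comp (Algebra.lsmul R R X))
    fun a ha => IsLocalizedModule.map_units mk ⟨a, ha⟩
  have hχ' (s : S) (x : X) (t : Localization W) : χ (φ s) (t ⊗ₜ x) = t ⊗ₜ (s • x) :=
    LinearMap.congr_fun (AlgHom.congr_fun hχ s) (t ⊗ₜ x)
  let := Module.compHom (Localization W ⊗[R] X) χ.toRingHom
  let Y : ModuleCat.{u} S' := ModuleCat.of S' (Localization W ⊗[R] X)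
  let e : Localization W ⊗[R] X ≃ₗ[R] (algRes φ).obj Y :=
    { AddEquiv.refl (Localization W ⊗[R] X) with
      map_smul' := fun r y => by
        change r • y = χ (φ (algebraMap R S r)) y
        rw [AlgHom.commutes, AlgHom.commutes]
        rfl }
  refine ⟨Y, ModuleCat.ofHom (Y := (algRes φ).obj Y)
    { (e.toLinearMap ∘ₗ mk).toAddMonoidHom with
      map_smul' := fun s x => (hχ' s x 1).symm }, IsLocalizedModule.of_linearEquiv W mk e⟩

lemma existsUnique_comp_map_eq {X : ModuleCat.{u} S} {Y Z : ModuleCat.{u} S'}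
    (l : X ⟶ (algRes φ).obj Y) (hl : IsLocalizationHom W l) (f : X ⟶ (algRes φ).obj Z) :
    ∃! g : Y ⟶ Z, l ≫ (algRes φ).map g = f := by
  have hZ := isUnit_algebraMap_end_algRes W φ Z
  have := full_algRes W φ
  obtain ⟨g, hg⟩ : ∃ g : (algRes φ).obj Y ⟶ (algRes φ).obj Z, l ≫ g = f := by
    obtain ⟨g, hg⟩ := exists_linearMap_comp_eq W l.hom hZ f.hom
    exact ⟨ConcreteCategory.ofHom g, ModuleCat.hom_ext hg⟩
  obtain ⟨g, rfl⟩ := (algRes φ).map_surjective g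
  refine ⟨g, hg, fun g' (hg' : l ≫ (algRes φ).map g' = f) => (algRes φ).map_injective <|
    ModuleCat.hom_ext <| LinearMap.restrictScalars_injective R <|
      IsLocalizedModule.ext W (l.hom.restrictScalars R) hZ <| LinearMap.ext fun x => ?_⟩
  exact ConcreteCategory.congr_hom (hg'.trans hg.symm) x

/-- A localization at `W` is a universal arrow to the functor `algRes φ`. -/
def isInitialMk {X : ModuleCat.{u} S} {Y : ModuleCat.{u} S'} (l : X ⟶ (algRes φ).obj Y)
    (hl : IsLocalizationHom W l) : Limits.IsInitial (StructuredArrow.mk l) :=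
  Limits.IsInitial.ofUniqueHom
    (fun A => StructuredArrow.homMk (existsUnique_comp_map_eq W φ l hl A.hom).choose
      (existsUnique_comp_map_eq W φ l hl A.hom).choose_spec.1)
    fun A g => StructuredArrow.ext _ _ <|
      (existsUnique_comp_map_eq W φ l hl A.hom).choose_spec.2 _ (StructuredArrow.w g)

include W in
lemma isRightAdjoint_algRes : (algRes φ).IsRightAdjoint := by
  have (X : ModuleCat.{u} S) : Limits.HasInitial (StructuredArrow X (algRes φ)) := by
    obtain ⟨Y, l, hl⟩ := exists_isLocalizationHom W φ X
    exact (isInitialMk W φ l hl).hasInitial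
  exact isRightAdjointOfStructuredArrowInitials _

variable {φ} {F : ModuleCat.{u} S ⥤ ModuleCat.{u} S'} (adj : F ⊣ algRes φ)

lemma isIso_homEquiv_symm_of_isLocalizationHom {X : ModuleCat.{u} S} {Y : ModuleCat.{u} S'}
    (l : X ⟶ (algRes φ).obj Y) (hl : IsLocalizationHom W l) :
    IsIso ((adj.homEquiv X Y).symm l) := by
  let g : (StructuredArrow.mk (adj.unit.app X) : StructuredArrow X (algRes φ)) ⟶
      StructuredArrow.mk l :=
    StructuredArrow.homMk ((adj.homEquiv X Y).symm l) <| by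
      simp [← Adjunction.homEquiv_unit]
  have := Limits.isIso_of_isInitial (mkInitialOfLeftAdjoint _ adj X) (isInitialMk W φ l hl) g
  exact inferInstanceAs (IsIso ((StructuredArrow.proj _ _).map g))

lemma isLocalizationHom_unit (X : ModuleCat.{u} S) :
    IsLocalizationHom W (adj.unit.app X) := by
  obtain ⟨Y, l, hl⟩ := exists_isLocalizationHom W φ X
  have := isIso_homEquiv_symm_of_isLocalizationHom W adj l hl
  let e := (algRes φ).mapIso (asIso ((adj.homEquiv X Y).symm l))
  have h : adj.unit.app X = l ≫ e.inv := by
    simp [e, ← Adjunction.homEquiv_unit]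
  rw [h]
  exact IsLocalizedModule.of_linearEquiv W (l.hom.restrictScalars R)
    (e.symm.toLinearEquiv.restrictScalars R)

include W adj in
lemma preservesMonomorphisms_of_adj_algRes : F.PreservesMonomorphisms where
  preserves {X Y} f hf := by
    have hX := isLocalizationHom_unit W adj X
    have hY := isLocalizationHom_unit W adj Y
    have h : ((algRes φ).map (F.map f)).hom.restrictScalars R = IsLocalizedModule.map W
        ((adj.unit.app X).hom.restrictScalars R) ((adj.unit.app Y).hom.restrictScalars R)
        (f.hom.restrictScalars R) := by
      refine IsLocalizedModule.linearMap_ext W ((adj.unit.app X).hom.restrictScalars R)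
        ((adj.unit.app Y).hom.restrictScalars R) ?_
      rw [IsLocalizedModule.map_comp]
      exact LinearMap.ext fun x => (ConcreteCategory.congr_hom (adj.unit.naturality f) x).symm
    rw [ModuleCat.mono_iff_injective] at hf ⊢
    have := IsLocalizedModule.map_injective W ((adj.unit.app X).hom.restrictScalars R)
      ((adj.unit.app Y).hom.restrictScalars R) (f.hom.restrictScalars R) hf
    rwa [← h] at this

include W adj in
lemma preservesHomology_of_adj_algRes [F.Additive] : F.PreservesHomology :=
  have := preservesMonomorphisms_of_adj_algRes W adj
  have := adj.leftAdjoint_preservesColimits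
  F.preservesHomology_of_preservesMonos_and_cokernels

end LocalizationFunctor

section Transposition

variable {C D : Type*} [Category* C] [Category* D] [Preadditive C] [Preadditive D]
  {F : C ⥤ D} {G : D ⥤ C} [F.Additive] [G.Additive] (adj : F ⊣ G)
  {P : CochainComplex C ℤ} {N : CochainComplex D ℤ}

/-- The bijection between morphisms `F P ⟶ N` and morphisms `P ⟶ G N` given by an adjunction,
for complexes. -/
def complexHomAddEquiv : ((F.mapHomologicalComplex _).obj P ⟶ N) ≃+
    (P ⟶ (G.mapHomologicalComplex _).obj N) where
  toFun u :=
    { f i := adj.homAddEquiv (P.X i) (N.X i) (u.f i)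
      comm' i j _ := (adj.homEquiv_naturality_right (u.f i) (N.d i j)).symm.trans <|
        (congrArg (adj.homEquiv (P.X i) (N.X j)) (u.comm i j)).trans <|
          adj.homEquiv_naturality_left (P.d i j) (u.f j) }
  invFun v :=
    { f i := (adj.homAddEquiv (P.X i) (N.X i)).symm (v.f i)
      comm' i j _ := (adj.homEquiv_naturality_right_symm (v.f i) (N.d i j)).symm.trans <|
        (congrArg (adj.homEquiv (P.X i) (N.X j)).symm (v.comm i j)).trans <|
          adj.homEquiv_naturality_left_symm (P.d i j) (v.f j) }
  left_inv u := by ext i : 1; exact (adj.homAddEquiv _ _).symm_apply_apply (u.f i)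
  right_inv v := by ext i : 1; exact (adj.homAddEquiv _ _).apply_symm_apply (v.f i)
  map_add' u v := by ext i : 1; exact (adj.homAddEquiv _ _).map_add (u.f i) (v.f i)

/-- The bijection between cochains from `F P` to `N` and cochains from `P` to `G N` given by an
adjunction. -/
def cochainAddEquiv (n : ℤ) : Cochain ((F.mapHomologicalComplex _).obj P) N n ≃+
    Cochain P ((G.mapHomologicalComplex _).obj N) n :=
  AddEquiv.piCongrRight fun t => adj.homAddEquiv (P.X t.p) (N.X t.q)

lemma cochainAddEquiv_δ (n m : ℤ) (z : Cochain ((F.mapHomologicalComplex _).obj P) N n) :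
    cochainAddEquiv adj m (δ n m z) = δ n m (cochainAddEquiv adj n z) := by
  by_cases h : n + 1 = m
  · ext p q hpq : 1
    rw [δ_v n m h _ p q hpq _ _ rfl rfl]
    let e := adj.homAddEquiv (P.X p) (N.X q)
    let x : F.obj (P.X p) ⟶ N.X q := z.v p (q - 1) (by lia) ≫ N.d (q - 1) q
    let y : F.obj (P.X p) ⟶ N.X q := F.map (P.d p (p + 1)) ≫ z.v (p + 1) q (by lia)
    calc e ((δ n m z).v p q hpq)
      _ = e (x + m.negOnePow • y) := congrArg e (δ_v n m h z p q hpq _ _ rfl rfl)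
      _ = e x + m.negOnePow • e y := by
        rw [map_add, Units.smul_def, map_zsmul, ← Units.smul_def]
      _ = _ := congrArg₂ (· + ·) (adj.homEquiv_naturality_right _ _)
        (congrArg (m.negOnePow • ·) (adj.homEquiv_naturality_left _ _))
  · rw [δ_shape _ _ h, δ_shape _ _ h, map_zero]

lemma cochainAddEquiv_ofHom (u : (F.mapHomologicalComplex _).obj P ⟶ N) :
    cochainAddEquiv adj 0 (Cochain.ofHom u) = Cochain.ofHom (complexHomAddEquiv adj u) := by
  ext p : 1
  rw [Cochain.ofHom_v]
  exact congrArg (adj.homAddEquiv (P.X p) (N.X p)) (Cochain.ofHom_v u p)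

lemma RepresentsHom.transpose {T : Type*} [AddCommGroup T]
    {β : T →+ ((F.mapHomologicalComplex _).obj P ⟶ N)} (hβ : RepresentsHom β) :
    RepresentsHom ((complexHomAddEquiv adj).toAddMonoidHom.comp β) where
  exact n hn z hz := by
    obtain ⟨z, rfl⟩ := (cochainAddEquiv adj n).surjective z
    rw [← cochainAddEquiv_δ, map_eq_zero_iff _ (cochainAddEquiv adj _).injective] at hz
    obtain ⟨w, rfl⟩ := hβ.exact n hn z hz
    exact ⟨_, (cochainAddEquiv_δ adj _ _ w).symm⟩
  surj u := by
    obtain ⟨u, rfl⟩ := (complexHomAddEquiv adj).surjective u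
    obtain ⟨t, w, h⟩ := hβ.surj u
    refine ⟨t, cochainAddEquiv adj _ w, ?_⟩
    rw [← cochainAddEquiv_ofHom, h, map_add, cochainAddEquiv_δ, cochainAddEquiv_ofHom]
    rfl
  inj t := by
    rintro ⟨w, hw⟩
    obtain ⟨w, rfl⟩ := (cochainAddEquiv adj (-1)).surjective w
    rw [← cochainAddEquiv_δ] at hw
    exact hβ.inj t ⟨w, (cochainAddEquiv adj 0).injective
      ((cochainAddEquiv_ofHom adj _).trans hw)⟩

end Transposition

section Resolution

variable {C : Type*} [Category* C] [Abelian C]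

lemma IsBounded.isKProjective {P : CochainComplex C ℤ} (hP : IsBounded P)
    [∀ i, Projective (P.X i)] : P.IsKProjective := by
  obtain ⟨a, b, hab⟩ := hP
  have : P.IsStrictlyLE b := (CochainComplex.isStrictlyLE_iff P b).2 fun i hi => hab i (Or.inr hi)
  exact CochainComplex.isKProjective_of_projective P b

lemma IsBounded.map {C D : Type*} [Category* C] [Category* D] [Preadditive C] [Preadditive D]
    {P : CochainComplex C ℤ} (hP : IsBounded P) (F : C ⥤ D) [F.Additive] :
    IsBounded ((F.mapHomologicalComplex _).obj P) := by
  obtain ⟨a, b, hab⟩ := hP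
  exact ⟨a, b, fun i hi => F.map_isZero (hab i hi)⟩

lemma RepresentsHom.of_quasiIso {P P' N N' : CochainComplex C ℤ} [P.IsKProjective]
    [P'.IsKProjective] {T : Type*} [AddCommGroup T] {α : T →+ (N ⟶ N)} {α' : T →+ (N' ⟶ N')}
    (p : P ⟶ N) [QuasiIso p] (p' : P' ⟶ N') [QuasiIso p'] (e : N ⟶ N') [QuasiIso e]
    (h : ∀ t, α t ≫ e = e ≫ α' t) (hα : RepresentsHom ((Preadditive.leftComp _ p).comp α)) :
    RepresentsHom ((Preadditive.leftComp _ p').comp α') := by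
  let := HasDerivedCategory.standard C
  refine hα.of_iso_Q _ (asIso (DerivedCategory.Q.map p) ≪≫ asIso (DerivedCategory.Q.map e) ≪≫
    (asIso (DerivedCategory.Q.map p')).symm) (asIso (DerivedCategory.Q.map e)) fun t => ?_
  change DerivedCategory.Q.map (p ≫ α t) ≫ DerivedCategory.Q.map e =
    (DerivedCategory.Q.map p ≫ DerivedCategory.Q.map e ≫ inv (DerivedCategory.Q.map p')) ≫
      DerivedCategory.Q.map (p' ≫ α' t)
  rw [← Functor.map_comp, Category.assoc, h]
  simp

end Resolution

section Transport

variable {E S T : Type u} [Ring E] [Ring S] [Ring T]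
  {f : S →+* E} {g : T →+* E} {h : ∀ s t, Commute (f s) (g t)}

lemma actComplex_naturality {M M' : CochainComplex (ModuleCat.{u} E) ℤ} (e : M ⟶ M') (t : T) :
    actComplex f g h t M ≫ ((ModuleCat.restrictScalars f).mapHomologicalComplex _).map e =
      ((ModuleCat.restrictScalars f).mapHomologicalComplex _).map e ≫ actComplex f g h t M' := by
  ext i x
  exact (e.f i).hom.map_smul (g t) x

lemma MulIsIso.of_iso {M M' : CochainComplex (ModuleCat.{u} E) ℤ} (e : M ≅ M')
    (hM : MulIsIso f g h M) : MulIsIso f g h M' := by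
  obtain ⟨P, p, hP, hp, hq⟩ := hM
  let e' := ((ModuleCat.restrictScalars f).mapHomologicalComplex (.up ℤ)).mapIso e
  refine ⟨P, p ≫ e'.hom, hP, inferInstance, ?_⟩
  rw [quasiIso_mulMap_iff] at hq ⊢
  exact hq.of_quasiIso p (p ≫ e'.hom) e'.hom (actComplex_naturality e.hom)

end Transport

section Localization

attribute [local instance] algBase algBase_tower linearModuleCat

variable {R S S' : Type u} [CommRing R] [Ring S] [Ring S'] [Algebra R S] [Algebra R S']
  (W : Submonoid R) {φ : S →ₐ[R] S'} [IsLocalizedModule W φ.toLinearMap]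
  {F : ModuleCat.{u} S ⥤ ModuleCat.{u} S'} [F.Additive] (adj : F ⊣ algRes φ)
  {P N : CochainComplex (ModuleCat.{u} S) ℤ} {N' : CochainComplex (ModuleCat.{u} S') ℤ}

instance : (algRes φ).Linear R where
  map_smul f r := by
    ext x
    change algebraMap R S' r • f x = φ (algebraMap R S r) • f x
    rw [AlgHom.commutes]

include W in
lemma quasiIso_complexHomAddEquiv_symm (p : P ⟶ N) [QuasiIso p]
    (l : N ⟶ ((algRes φ).mapHomologicalComplex _).obj N')
    (hl : ∀ i, IsLocalizationHom W (l.f i)) :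
    QuasiIso ((complexHomAddEquiv adj).symm (p ≫ l)) := by
  have := preservesHomology_of_adj_algRes W adj
  let lF := (complexHomAddEquiv adj).symm l
  have (i : ℤ) : IsIso (lF.f i) := isIso_homEquiv_symm_of_isLocalizationHom W adj (l.f i) (hl i)
  have : IsIso lF := HomologicalComplex.Hom.isIso_of_components _
  have h : (complexHomAddEquiv adj).symm (p ≫ l) =
      (F.mapHomologicalComplex _).map p ≫ lF := by
    ext i : 1
    exact adj.homEquiv_naturality_left_symm (p.f i) (l.f i)
  rw [h]
  infer_instance

/-- Extension of scalars turns a resolution of `N` into one of its localization `N'`. -/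
theorem representsHom_of_isLocalizationHom (hP : IsBounded P) [∀ i, Projective (P.X i)]
    (p : P ⟶ N) [QuasiIso p] (l : N ⟶ ((algRes φ).mapHomologicalComplex _).obj N')
    (hl : ∀ i, IsLocalizationHom W (l.f i)) {P' : CochainComplex (ModuleCat.{u} S') ℤ}
    [P'.IsKProjective] (p' : P' ⟶ N') [QuasiIso p'] {T' : Type*} [AddCommGroup T']
    (α' : T' →+ (N' ⟶ N')) (hα' : RepresentsHom ((Preadditive.leftComp _ p').comp α')) :
    RepresentsHom ((Preadditive.leftComp _ (p ≫ l)).comp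
      (((algRes φ).mapHomologicalComplex _).mapAddHom.comp α')) := by
  have := isRightAdjoint_algRes W φ
  let F := (algRes φ).leftAdjoint
  let adj : F ⊣ algRes φ := Adjunction.ofIsRightAdjoint _
  have : F.Additive := adj.left_adjoint_additive
  let q := (complexHomAddEquiv adj).symm (p ≫ l)
  have : QuasiIso q := quasiIso_complexHomAddEquiv_symm W adj p l hl
  have (i : ℤ) : Projective (((F.mapHomologicalComplex (.up ℤ)).obj P).X i) :=
    adj.map_projective (P.X i) inferInstance
  have := (hP.map F).isKProjective
  have h := (hα'.of_quasiIso (α' := α') p' q (𝟙 N') fun t => by simp).transpose adj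
  convert! h using 1
  refine AddMonoidHom.ext fun t => HomologicalComplex.hom_ext _ _ fun i => ?_
  have hq : (complexHomAddEquiv adj) q = p ≫ l := (complexHomAddEquiv adj).apply_symm_apply _
  exact ((adj.homEquiv_naturality_right (q.f i) ((α' t).f i)).trans
    (congrArg (fun v => v.f i ≫ (algRes φ).map ((α' t).f i)) hq)).symm

end Localization

section LinearAction

attribute [local instance] algBase algBase_tower linearModuleCat

variable {R E S T : Type u} [CommRing R] [Ring E] [Ring S] [Ring T] [Algebra R E] [Algebra R S]
  [Algebra R T] (f : S →ₐ[R] E) (g : T →ₐ[R] E) (h : ∀ s t, Commute (f s) (g t))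

/-- The `R`-linear version of `actionHom`. -/
def actionLinear (M : CochainComplex (ModuleCat.{u} E) ℤ) :
    T →ₗ[R] (((ModuleCat.restrictScalars f.toRingHom).mapHomologicalComplex (.up ℤ)).obj M ⟶
      ((ModuleCat.restrictScalars f.toRingHom).mapHomologicalComplex (.up ℤ)).obj M) :=
  { actionHom f.toRingHom g.toRingHom h M with
    map_smul' := fun r t => by
      ext i x
      change g (r • t) • (show M.X i from x) =
        f (algebraMap R S r) • g t • (show M.X i from x)
      rw [map_smul, Algebra.smul_def, mul_smul, AlgHom.commutes] }

/-- The family `t ↦ (x ↦ t • p x)` of morphisms `P ⟶ M`. -/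
def derivedAction {M : CochainComplex (ModuleCat.{u} E) ℤ}
    {P : CochainComplex (ModuleCat.{u} S) ℤ}
    (p : P ⟶ ((ModuleCat.restrictScalars f.toRingHom).mapHomologicalComplex _).obj M) :
    T →ₗ[R] (P ⟶ ((ModuleCat.restrictScalars f.toRingHom).mapHomologicalComplex _).obj M) :=
  Linear.leftComp R _ p ∘ₗ actionLinear f g h M

lemma MulIsIso.of_forall_maximal {M : CochainComplex (ModuleCat.{u} E) ℤ}
    (hM : IsPerfect (((ModuleCat.restrictScalars f.toRingHom).mapHomologicalComplex _).obj M))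
    (H : ∀ {P} (p : P ⟶ ((ModuleCat.restrictScalars f.toRingHom).mapHomologicalComplex _).obj M)
      [QuasiIso p], IsBounded P → (∀ i, Module.Finite S (P.X i) ∧ Module.Projective S (P.X i)) →
      ∀ (m : Ideal R) [m.IsMaximal], RepresentsHomAt m.primeCompl (derivedAction f g h p)) :
    MulIsIso f.toRingHom g.toRingHom h M := by
  obtain ⟨P, p, hP, hfP, hp⟩ := hM
  have (i : ℤ) : Projective (P.X i) :=
    have := (hfP i).2
    inferInstance
  exact ⟨P, p, IsBounded.isKProjective hP, hp,
    (quasiIso_mulMap_iff ..).2 (RepresentsHom.of_forall_maximal _ (H p hP hfP))⟩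

end LinearAction

section LocalizedAction

attribute [local instance] algBase algBase_tower linearModuleCat

variable {R S S' : Type u} [CommRing R] [Ring S] [Ring S'] [Algebra R S] [Algebra R S']

/-- Restriction of scalars along `f` does not change the underlying `R`-module. -/
def algResEquiv (f : S →ₐ[R] S') (X : ModuleCat.{u} S') :
    (ModuleCat.restrictScalars f.toRingHom).obj X ≃ₗ[R] X :=
  { AddEquiv.refl X with
    map_smul' := fun r x => by
      change f (algebraMap R S r) • (show X from x) = algebraMap R S' r • (show X from x)
      rw [AlgHom.commutes] }

variable {E E' : Type u} [Ring E] [Ring E'] [Algebra R E] [Algebra R E']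
  {φ : S →ₐ[R] S'} {θ : E →ₐ[R] E'} {f : S →ₐ[R] E} {f' : S' →ₐ[R] E'}
  (hf : θ.comp f = f'.comp φ)

/-- The `S`-linear map underlying an `E`-linear map `M ⟶ M'`, for a ring homomorphism
`E → E'` over `S → S'`. -/
def restrictHom {X : ModuleCat.{u} E} {Y : ModuleCat.{u} E'} (k : X ⟶ (algRes θ).obj Y) :
    (ModuleCat.restrictScalars f.toRingHom).obj X ⟶
      (algRes φ).obj ((ModuleCat.restrictScalars f'.toRingHom).obj Y) :=
  ModuleCat.ofHom (X := (ModuleCat.restrictScalars f.toRingHom).obj X)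
    (Y := (algRes φ).obj ((ModuleCat.restrictScalars f'.toRingHom).obj Y))
    { toFun := k.hom
      map_add' := k.hom.map_add
      map_smul' := fun s x => (k.hom.map_smul (f s) x).trans <| by
        change θ.comp f s • (show Y from k.hom x) = f' (φ s) • (show Y from k.hom x)
        rw [hf]
        rfl }

lemma isLocalizationHom_restrictHom (W : Submonoid R) {X : ModuleCat.{u} E} {Y : ModuleCat.{u} E'}
    (k : X ⟶ (algRes θ).obj Y) (hk : IsLocalizationHom W k) :
    IsLocalizationHom W (restrictHom hf k) := by
  let e : (algRes θ).obj Y ≃ₗ[R]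
      (algRes φ).obj ((ModuleCat.restrictScalars f'.toRingHom).obj Y) :=
    (algResEquiv θ Y).trans <| (algResEquiv f' Y).symm.trans (algResEquiv φ _).symm
  have := IsLocalizedModule.of_linearEquiv W (k.hom.restrictScalars R) e
  exact IsLocalizedModule.of_linearEquiv_right W (e.toLinearMap ∘ₗ k.hom.restrictScalars R)
    (algResEquiv f X)

/-- `restrictHom` for complexes. -/
def restrictHomComplex {M : CochainComplex (ModuleCat.{u} E) ℤ}
    {M' : CochainComplex (ModuleCat.{u} E') ℤ}
    (k : M ⟶ ((algRes θ).mapHomologicalComplex _).obj M') :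
    ((ModuleCat.restrictScalars f.toRingHom).mapHomologicalComplex _).obj M ⟶
      ((algRes φ).mapHomologicalComplex _).obj
        (((ModuleCat.restrictScalars f'.toRingHom).mapHomologicalComplex _).obj M') where
  f i := restrictHom hf (k.f i)
  comm' i j _ := by
    ext x
    exact ConcreteCategory.congr_hom (k.comm i j) x

variable {T T' : Type u} [Ring T] [Ring T'] [Algebra R T] [Algebra R T']
  {ψ : T →ₐ[R] T'} {g : T →ₐ[R] E} {g' : T' →ₐ[R] E'} (hg : θ.comp g = g'.comp ψ)
  {h : ∀ s t, Commute (f s) (g t)} {h' : ∀ s t, Commute (f' s) (g' t)}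
  {M : CochainComplex (ModuleCat.{u} E) ℤ} {M' : CochainComplex (ModuleCat.{u} E') ℤ}
  (k : M ⟶ ((algRes θ).mapHomologicalComplex _).obj M')
  {P : CochainComplex (ModuleCat.{u} S) ℤ}
  (p : P ⟶ ((ModuleCat.restrictScalars f.toRingHom).mapHomologicalComplex _).obj M)

variable (φ h') in
/-- The family of morphisms `P ⟶ M'` through which `T'` acts. -/
def restrictedAction (l : P ⟶ ((algRes φ).mapHomologicalComplex _).obj
    (((ModuleCat.restrictScalars f'.toRingHom).mapHomologicalComplex _).obj M')) :
    T' →ₗ[R] (P ⟶ ((algRes φ).mapHomologicalComplex _).obj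
      (((ModuleCat.restrictScalars f'.toRingHom).mapHomologicalComplex _).obj M')) :=
  Linear.leftComp R _ l ∘ₗ ((algRes φ).mapHomologicalComplex _).mapLinearMap R ∘ₗ
    actionLinear f' g' h' M'

include hf hg in
theorem representsHomAt_derivedAction (W : Submonoid R) [IsLocalizedModule W φ.toLinearMap]
    [IsLocalizedModule W ψ.toLinearMap] (hk : ∀ i, IsLocalizationHom W (k.f i))
    (hP : IsBounded P) (hfP : ∀ i, Module.Finite S (P.X i) ∧ Module.Projective S (P.X i))
    [QuasiIso p] (hM' : MulIsIso f'.toRingHom g'.toRingHom h' M') :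
    RepresentsHomAt W (derivedAction f g h p) := by
  obtain ⟨P', p', hP', hp', hq⟩ := hM'
  have (i : ℤ) : Projective (P.X i) :=
    have := (hfP i).2
    inferInstance
  have (i : ℤ) : Module.FinitePresentation S (P.X i) :=
    have ⟨_, _⟩ := hfP i
    Module.finitePresentation_of_projective S (P.X i)
  let l := restrictHomComplex hf k
  have hl (i : ℤ) : IsLocalizationHom W (l.f i) :=
    isLocalizationHom_restrictHom hf W (k.f i) (hk i)
  refine .of_isLocalizationHom W hP hl ψ.toLinearMap _ (restrictedAction φ h' (p ≫ l))
    (representsHom_of_isLocalizationHom W hP p l hl p' _ ((quasiIso_mulMap_iff ..).1 hq))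
    fun t => ?_
  ext i x
  refine ((k.f i).hom.map_smul (g t) (p.f i x)).trans ?_
  exact congrArg (fun e : E' => e • (show M'.X i from (k.f i).hom (p.f i x)))
    (AlgHom.congr_fun hg t)

end LocalizedAction

section BimoduleLocalization

attribute [local instance] algBase algBase_tower linearModuleCat

section EnvelopingAlgebra

variable (R R' A : Type u) [CommRing R] [CommRing R'] [Algebra R R'] [Ring A] [Algebra R A]
  [Algebra R' A] [IsScalarTower R R' A]

/-- `inl`, as a homomorphism of algebras over a ring `R` below the base ring `R'`. -/
def inlAlg : A →ₐ[R] Env R' A :=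
  (Algebra.TensorProduct.includeLeft : A →ₐ[R'] Env R' A).restrictScalars R

/-- `inr`, as a homomorphism of algebras over a ring `R` below the base ring `R'`. -/
def inrAlg : Aᵐᵒᵖ →ₐ[R] Env R' A :=
  (Algebra.TensorProduct.includeRight : Aᵐᵒᵖ →ₐ[R'] Env R' A).restrictScalars R

lemma commute_inlAlg_inrAlg (a : A) (b : Aᵐᵒᵖ) : Commute (inlAlg R R' A a) (inrAlg R R' A b) :=
  commute_inl_inr R' A a b

end EnvelopingAlgebra

variable {R R' A A' : Type u} [CommRing R] [CommRing R'] [Algebra R R'] [Ring A] [Ring A']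
  [Algebra R A] [Algebra R A'] [Algebra R' A'] [IsScalarTower R R' A']

variable (R') in
/-- The homomorphism `A ⊗ Aᵐᵒᵖ → A' ⊗ A'ᵐᵒᵖ` induced by `φ : A → A'`. -/
def envMap (φ : A →ₐ[R] A') : Env R A →ₐ[R] Env R' A' :=
  Algebra.TensorProduct.lift ((inlAlg R R' A').comp φ) ((inrAlg R R' A').comp (AlgHom.op φ))
    fun _ _ => commute_inlAlg_inrAlg R R' A' _ _

lemma envMap_tmul (φ : A →ₐ[R] A') (a : A) (b : Aᵐᵒᵖ) :
    envMap R' φ (a ⊗ₜ b) = φ a ⊗ₜ AlgHom.op φ b :=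
  (Algebra.TensorProduct.lift_tmul _ _ _ a b).trans <|
    (Algebra.TensorProduct.tmul_mul_tmul ..).trans <| by rw [mul_one, one_mul]; rfl

lemma envMap_comp_inlAlg (φ : A →ₐ[R] A') :
    (envMap R' φ).comp (inlAlg R R A) = (inlAlg R R' A').comp φ :=
  AlgHom.ext fun a => (envMap_tmul φ a 1).trans (by rw [map_one]; rfl)

lemma envMap_comp_inrAlg (φ : A →ₐ[R] A') :
    (envMap R' φ).comp (inrAlg R R A) = (inrAlg R R' A').comp (AlgHom.op φ) :=
  AlgHom.ext fun b => (envMap_tmul φ 1 b).trans (by rw [map_one]; rfl)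

instance isLocalizedModule_op (W : Submonoid R) (φ : A →ₐ[R] A')
    [IsLocalizedModule W φ.toLinearMap] :
    IsLocalizedModule W (AlgHom.op φ).toLinearMap :=
  have := IsLocalizedModule.of_linearEquiv W φ.toLinearMap (opLinearEquiv R : A' ≃ₗ[R] A'ᵐᵒᵖ)
  IsLocalizedModule.of_linearEquiv_right W
    ((opLinearEquiv R : A' ≃ₗ[R] A'ᵐᵒᵖ).toLinearMap ∘ₗ φ.toLinearMap)
    (opLinearEquiv R : A ≃ₗ[R] Aᵐᵒᵖ).symm

variable (W : Submonoid R) (φ : A →ₐ[R] A') [IsLocalizedModule W φ.toLinearMap]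
  {M : CochainComplex (ModuleCat.{u} (Env R A)) ℤ}
  {M' : CochainComplex (ModuleCat.{u} (Env R' A')) ℤ}
  (k : M ⟶ ((algRes (envMap R' φ)).mapHomologicalComplex _).obj M')
  (hk : ∀ i, IsLocalizationHom W (k.f i)) (hM' : IsTilting R' A' M')

include k hk hM'

theorem representsHomAt_left_mul {P : CochainComplex (ModuleCat.{u} Aᵐᵒᵖ) ℤ}
    (p : P ⟶ ((ModuleCat.restrictScalars (inrAlg R R A).toRingHom).mapHomologicalComplex _).obj M)
    [QuasiIso p] (hP : IsBounded P)
    (hfP : ∀ i, Module.Finite Aᵐᵒᵖ (P.X i) ∧ Module.Projective Aᵐᵒᵖ (P.X i)) :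
    RepresentsHomAt W (derivedAction (inrAlg R R A) (inlAlg R R A)
      (fun b a => (commute_inlAlg_inrAlg R R A a b).symm) p) :=
  representsHomAt_derivedAction (envMap_comp_inrAlg φ) (envMap_comp_inlAlg φ) k p W hk hP hfP
    (h' := fun b a => (commute_inlAlg_inrAlg R R' A' a b).symm) hM'.left_mul

theorem representsHomAt_right_mul {P : CochainComplex (ModuleCat.{u} A) ℤ}
    (p : P ⟶ ((ModuleCat.restrictScalars (inlAlg R R A).toRingHom).mapHomologicalComplex _).obj M)
    [QuasiIso p] (hP : IsBounded P)
    (hfP : ∀ i, Module.Finite A (P.X i) ∧ Module.Projective A (P.X i)) :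
    RepresentsHomAt W (derivedAction (inlAlg R R A) (inrAlg R R A)
      (commute_inlAlg_inrAlg R R A) p) :=
  representsHomAt_derivedAction (envMap_comp_inlAlg φ) (envMap_comp_inrAlg φ) k p W hk hP hfP
    (h' := commute_inlAlg_inrAlg R R' A') hM'.right_mul

end BimoduleLocalization

section LocalGlobalTilting

attribute [local instance] algBase algBase_tower linearModuleCat

variable {R : Type u} [CommRing R] (m : Ideal R) [m.IsPrime] (Γ : Type u) [Ring Γ] [Algebra R Γ]

/-- The localization map `Γ → Γ_m`. -/
abbrev toLocAlg : Γ →ₐ[R] LocAlg m Γ := Algebra.TensorProduct.includeRight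

instance isLocalizedModule_toLocAlg :
    IsLocalizedModule m.primeCompl (toLocAlg m Γ).toLinearMap :=
  (isLocalizedModule_iff_isBaseChange m.primeCompl (Localization.AtPrime m) _).2
    (TensorProduct.isBaseChange R Γ _)

lemma locAct_envMap_toLocAlg (M : ModuleCat.{u} (Env R Γ)) (e : Env R Γ) (x : M) :
    locAct m Γ M (envMap (Localization.AtPrime m) (toLocAlg m Γ) e) (1 ⊗ₜ x) = 1 ⊗ₜ (e • x) := by
  induction e using TensorProduct.induction_on with
  | zero =>
    rw [map_zero, map_zero, LinearMap.zero_apply]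
    exact ((congrArg _ (zero_smul (Env R Γ) x)).trans (tmul_zero _ _)).symm
  | add e e' he he' => rw [map_add, map_add, LinearMap.add_apply, he, he', add_smul, tmul_add]
  | tmul a b =>
    rw [envMap_tmul]
    refine (locAct_tmul m Γ M 1 1 1 a b.unop x).trans ?_
    rw [smul_smul]
    simp

/-- The localization map `M → M_m` of a bimodule `M`. -/
def toLocObj (M : ModuleCat.{u} (Env R Γ)) :
    M ⟶ (algRes (envMap (Localization.AtPrime m) (toLocAlg m Γ))).obj (locObj m Γ M) :=
  ModuleCat.ofHom
    (Y := (algRes (envMap (Localization.AtPrime m) (toLocAlg m Γ))).obj (locObj m Γ M))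
    { toFun := fun x => (1 ⊗ₜ x : LocMod m Γ M)
      map_add' := tmul_add 1
      map_smul' := fun e x => (locAct_envMap_toLocAlg m Γ M e x).symm }

lemma isLocalizationHom_toLocObj (M : ModuleCat.{u} (Env R Γ)) :
    IsLocalizationHom m.primeCompl (toLocObj m Γ M) := by
  have := (isLocalizedModule_iff_isBaseChange m.primeCompl (Localization.AtPrime m) _).2
    (TensorProduct.isBaseChange R M _)
  let e : LocMod m Γ M ≃ₗ[R]
      (algRes (envMap (Localization.AtPrime m) (toLocAlg m Γ))).obj (locObj m Γ M) :=
    { AddEquiv.refl (LocMod m Γ M) with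
      map_smul' := fun r y => by
        change r • y = locAct m Γ M (envMap _ (toLocAlg m Γ) (algebraMap R _ r)) y
        rw [AlgHom.commutes, IsScalarTower.algebraMap_apply R (Localization.AtPrime m),
          AlgHom.commutes, Module.algebraMap_end_apply, algebraMap_smul] }
  exact IsLocalizedModule.of_linearEquiv m.primeCompl
    (TensorProduct.mk R (Localization.AtPrime m) M 1) e

/-- The localization map `M → M_m` of a complex of bimodules `M`. -/
def toLocComplex (M : CochainComplex (ModuleCat.{u} (Env R Γ)) ℤ) :
    M ⟶ ((algRes (envMap (Localization.AtPrime m) (toLocAlg m Γ))).mapHomologicalComplex _).obj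
      (locComplex m Γ M) where
  f i := toLocObj m Γ (M.X i)

variable {Γ} in
theorem isTilting_of_forall_maximal {M : CochainComplex (ModuleCat.{u} (Env R Γ)) ℤ}
    (hM : IsBiperfect R Γ M) (H : ∀ (m : Ideal R) [m.IsMaximal],
      IsTilting (Localization.AtPrime m) (LocAlg m Γ) (locComplex m Γ M)) :
    IsTilting R Γ M where
  biperfect := hM
  left_mul :=
    MulIsIso.of_forall_maximal (inrAlg R R Γ) (inlAlg R R Γ) _ hM.2 fun p _ hP hfP m _ =>
      representsHomAt_left_mul m.primeCompl (toLocAlg m Γ) (toLocComplex m Γ M)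
        (fun i => isLocalizationHom_toLocObj m Γ (M.X i)) (H m) p hP hfP
  right_mul :=
    MulIsIso.of_forall_maximal (inlAlg R R Γ) (inrAlg R R Γ) _ hM.1 fun p _ hP hfP m _ =>
      representsHomAt_right_mul m.primeCompl (toLocAlg m Γ) (toLocComplex m Γ M)
        (fun i => isLocalizationHom_toLocObj m Γ (M.X i)) (H m) p hP hfP

end LocalGlobalTilting

section Projective

attribute [local instance] algBase algBase_tower linearModuleCat

section Adjunction

variable {R S S' : Type u} [CommRing R] [Ring S] [Ring S'] [Algebra R S] [Algebra R S']
  (W : Submonoid R) {φ : S →ₐ[R] S'} [IsLocalizedModule W φ.toLinearMap]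
  {F : ModuleCat.{u} S ⥤ ModuleCat.{u} S'} (adj : F ⊣ algRes φ)

include W adj

lemma exists_smul_id_eq_comp_of_projective {X Q : ModuleCat.{u} S}
    [Module.FinitePresentation S X] (π : Q ⟶ X) [Epi π] (h : Projective (F.obj X)) :
    ∃ (σ : X ⟶ Q), ∃ a ∈ W, σ ≫ π = a • 𝟙 X := by
  let η (Z : ModuleCat.{u} S) : Z ⟶ (algRes φ).obj (F.obj Z) := adj.unit.app Z
  have hη : π ≫ η X = η Q ≫ (algRes φ).map (F.map π) := adj.unit.naturality π
  have : IsLocalizationHom W (η X) := isLocalizationHom_unit W adj X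
  have : IsLocalizationHom W (η Q) := isLocalizationHom_unit W adj Q
  have := F.preservesEpimorphisms_of_adjunction adj
  let s := Projective.factorThru (𝟙 _) (F.map π)
  have hs : s ≫ F.map π = 𝟙 _ := Projective.factorThru_comp _ _
  obtain ⟨σ, a, ha, hσ⟩ := exists_lift_of_finitePresentation W (η Q).hom
    (η X ≫ (algRes φ).map s).hom
  have hσ' : ModuleCat.ofHom σ ≫ η Q = a • (η X ≫ (algRes φ).map s) := ModuleCat.hom_ext hσ
  have hπ : (ModuleCat.ofHom σ ≫ π) ≫ η X = (a • 𝟙 X) ≫ η X := by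
    calc (ModuleCat.ofHom σ ≫ π) ≫ η X
        = (ModuleCat.ofHom σ ≫ η Q) ≫ (algRes φ).map (F.map π) := by
          rw [Category.assoc, hη, Category.assoc]
      _ = a • (η X ≫ (algRes φ).map (s ≫ F.map π)) := by
          rw [hσ', Linear.smul_comp, Category.assoc, Functor.map_comp]
      _ = (a • 𝟙 X) ≫ η X := by
          rw [hs, CategoryTheory.Functor.map_id, Category.comp_id, Linear.smul_comp,
            Category.id_comp]
  obtain ⟨b, hb, hbz⟩ := exists_smul_eq_zero_of_comp_eq_zero W (η X).hom
    (ModuleCat.ofHom σ ≫ π - a • 𝟙 X).hom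
    (congrArg ModuleCat.Hom.hom ((Preadditive.sub_comp ..).trans (sub_eq_zero.2 hπ)))
  have hb' : b • (ModuleCat.ofHom σ ≫ π - a • 𝟙 X) = 0 := ModuleCat.hom_ext hbz
  refine ⟨b • ModuleCat.ofHom σ, b * a, mul_mem hb ha, ?_⟩
  rwa [Linear.smul_comp, mul_smul, ← sub_eq_zero, ← smul_sub]

lemma hasProjectiveDimensionLE_of_isLocalizationHom {X : ModuleCat.{u} S}
    {Y : ModuleCat.{u} S'} (l : X ⟶ (algRes φ).obj Y) (hl : IsLocalizationHom W l) (n : ℕ)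
    [HasProjectiveDimensionLE Y n] : HasProjectiveDimensionLE (F.obj X) n :=
  have := isIso_homEquiv_symm_of_isLocalizationHom W adj l hl
  hasProjectiveDimensionLT_of_iso (asIso ((adj.homEquiv X Y).symm l)).symm (n + 1)

lemma hasProjectiveDimensionLE_X₁_of_shortExact {T : ShortComplex (ModuleCat.{u} S)}
    (hT : T.ShortExact) [Projective T.X₂] (n : ℕ)
    (h : HasProjectiveDimensionLE (F.obj T.X₃) (n + 1)) :
    HasProjectiveDimensionLE (F.obj T.X₁) n := by
  have := adj.left_adjoint_additive
  have := preservesHomology_of_adj_algRes W adj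
  have := F.preservesFiniteLimits_of_preservesHomology
  have := F.preservesFiniteColimits_of_preservesHomology
  exact ((hT.map_of_exact F).hasProjectiveDimensionLT_X₃_iff n
    (adj.map_projective T.X₂ inferInstance)).1 h

end Adjunction

variable {R S : Type u} [CommRing R] [Ring S] [Algebra R S] {W : Submonoid R}

variable (W) in
/-- The localization `W⁻¹X` has projective dimension at most `n` over `W⁻¹S`. The ring and the
module are any models of the localizations: they are unique up to isomorphism. -/
def HasLocalProjectiveDimensionLE (X : ModuleCat.{u} S) (n : ℕ) : Prop :=
  ∃ (S' : Type u) (_ : Ring S') (_ : Algebra R S') (φ : S →ₐ[R] S')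
    (_ : IsLocalizedModule W φ.toLinearMap) (Y : ModuleCat.{u} S') (l : X ⟶ (algRes φ).obj Y),
    IsLocalizationHom W l ∧ HasProjectiveDimensionLE Y n

namespace HasLocalProjectiveDimensionLE

lemma exists_smul_id_eq_comp {X Q : ModuleCat.{u} S} (h : HasLocalProjectiveDimensionLE W X 0)
    [Module.FinitePresentation S X] (π : Q ⟶ X) [Epi π] :
    ∃ (σ : X ⟶ Q), ∃ a ∈ W, σ ≫ π = a • 𝟙 X := by
  obtain ⟨S', _, _, φ, _, Y, l, hl, hY⟩ := h
  have := isRightAdjoint_algRes W φ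
  have hX := hasProjectiveDimensionLE_of_isLocalizationHom W (.ofIsRightAdjoint (algRes φ)) l hl 0
  exact exists_smul_id_eq_comp_of_projective W (.ofIsRightAdjoint (algRes φ)) π
    ((projective_iff_hasProjectiveDimensionLE_zero _).2 hX)

lemma X₁_of_shortExact {T : ShortComplex (ModuleCat.{u} S)} {n : ℕ}
    (h : HasLocalProjectiveDimensionLE W T.X₃ (n + 1)) (hT : T.ShortExact) [Projective T.X₂] :
    HasLocalProjectiveDimensionLE W T.X₁ n := by
  obtain ⟨S', _, _, φ, _, Y, l, hl, hY⟩ := h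
  have := isRightAdjoint_algRes W φ
  let adj := Adjunction.ofIsRightAdjoint (algRes φ)
  exact ⟨S', _, _, φ, inferInstance, _, adj.unit.app T.X₁, isLocalizationHom_unit W adj T.X₁,
    hasProjectiveDimensionLE_X₁_of_shortExact W adj hT n
      (hasProjectiveDimensionLE_of_isLocalizationHom W adj l hl (n + 1))⟩

lemma restrictScalars {E S' E' : Type u} [Ring E] [Ring S'] [Ring E'] [Algebra R E]
    [Algebra R S'] [Algebra R E'] {φ : S →ₐ[R] S'} [IsLocalizedModule W φ.toLinearMap]
    {θ : E →ₐ[R] E'} {f : S →ₐ[R] E} {f' : S' →ₐ[R] E'} (hf : θ.comp f = f'.comp φ)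
    {X : ModuleCat.{u} E} {Y : ModuleCat.{u} E'} (k : X ⟶ (algRes θ).obj Y)
    (hk : IsLocalizationHom W k) {n : ℕ}
    (hY : HasProjectiveDimensionLE ((ModuleCat.restrictScalars f'.toRingHom).obj Y) n) :
    HasLocalProjectiveDimensionLE W ((ModuleCat.restrictScalars f.toRingHom).obj X) n :=
  ⟨S', _, _, φ, inferInstance, _, restrictHom hf k, isLocalizationHom_restrictHom hf W k hk, hY⟩

end HasLocalProjectiveDimensionLE

end Projective

section Perfect

variable {S : Type u} [Ring S]

lemma exists_finite_projective_epi (X : ModuleCat.{u} S) [Module.Finite S X] :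
    ∃ (F : ModuleCat.{u} S) (π : F ⟶ X), Module.Finite S F ∧ Projective F ∧ Epi π := by
  obtain ⟨k, π, hπ⟩ := Module.Finite.exists_fin' S X
  exact ⟨ModuleCat.of S (Fin k → S), ModuleCat.ofHom π,
    inferInstanceAs (Module.Finite S (Fin k → S)), inferInstance,
    (ModuleCat.epi_iff_surjective _).2 hπ⟩

lemma IsPerfect.of_quasiIso {X Y : CochainComplex (ModuleCat.{u} S) ℤ} (hX : IsPerfect X)
    (q : X ⟶ Y) [QuasiIso q] : IsPerfect Y := by
  obtain ⟨P, p, hP, hfp, hp⟩ := hX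
  exact ⟨P, p ≫ q, hP, hfp, inferInstance⟩

lemma IsPerfect.mapHomologicalComplex_inDegreeZero {E : Type u} [Ring E]
    (f : S →+* E) (M : ModuleCat.{u} E)
    (h : IsPerfect (inDegreeZero ((ModuleCat.restrictScalars f).obj M))) :
    IsPerfect (((ModuleCat.restrictScalars f).mapHomologicalComplex _).obj (inDegreeZero M)) :=
  h.of_quasiIso ((HomologicalComplex.singleMapHomologicalComplex (ModuleCat.restrictScalars f)
    (ComplexShape.up ℤ) 0).app M).inv

lemma isBounded_inDegreeZero (X : ModuleCat.{u} S) : IsBounded (inDegreeZero X) :=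
  ⟨0, 0, fun _ _ => HomologicalComplex.isZero_single_obj_X _ _ _ _ (by omega)⟩

lemma finite_projective_inDegreeZero_X (X : ModuleCat.{u} S) [Module.Finite S X] [Projective X]
    (i : ℤ) : Module.Finite S ((inDegreeZero X).X i) ∧
      Module.Projective S ((inDegreeZero X).X i) := by
  by_cases hi : i = 0
  · subst hi
    let ε := (HomologicalComplex.singleObjXSelf (ComplexShape.up ℤ) (0 : ℤ) X).toLinearEquiv.symm
    have : Module.Projective S X := (IsProjective.iff_projective X).2 inferInstance
    exact ⟨Module.Finite.equiv ε, Module.Projective.of_equiv ε⟩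
  · have := ModuleCat.subsingleton_of_isZero (HomologicalComplex.isZero_single_obj_X
      (ComplexShape.up ℤ) 0 X i hi)
    exact ⟨inferInstance, inferInstance⟩

lemma isPerfect_inDegreeZero_of_projective (X : ModuleCat.{u} S) [Module.Finite S X]
    [Projective X] : IsPerfect (inDegreeZero X) :=
  ⟨_, 𝟙 _, isBounded_inDegreeZero X, finite_projective_inDegreeZero_X X, inferInstance⟩

lemma quasiIso_mappingCone_map {C : Type*} [Category* C] [Abelian C]
    {K₁ L₁ K₂ L₂ : CochainComplex C ℤ} (φ₁ : K₁ ⟶ L₁) (φ₂ : K₂ ⟶ L₂) (a : K₁ ⟶ K₂) (b : L₁ ⟶ L₂)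
    (comm : φ₁ ≫ b = a ≫ φ₂) [QuasiIso a] [QuasiIso b] :
    QuasiIso (mappingCone.map φ₁ φ₂ a b comm) := by
  let := HasDerivedCategory.standard C
  rw [← DerivedCategory.isIso_Q_map_iff_quasiIso]
  exact Pretriangulated.isIso₃_of_isIso₁₂
    (DerivedCategory.Q.mapTriangle.map (mappingCone.triangleMap φ₁ φ₂ a b comm))
    (DerivedCategory.mappingCone_triangle_distinguished φ₁)
    (DerivedCategory.mappingCone_triangle_distinguished φ₂)
    (inferInstanceAs (IsIso (DerivedCategory.Q.map a)))
    (inferInstanceAs (IsIso (DerivedCategory.Q.map b)))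

lemma IsPerfect.X₃_of_shortExact {T : ShortComplex (CochainComplex (ModuleCat.{u} S) ℤ)}
    (hT : T.ShortExact) (h₁ : IsPerfect T.X₁) (hb : IsBounded T.X₂)
    (hfp : ∀ i, Module.Finite S (T.X₂.X i) ∧ Module.Projective S (T.X₂.X i)) :
    IsPerfect T.X₃ := by
  obtain ⟨P, p, ⟨a, b, hP⟩, hfP, hp⟩ := h₁
  obtain ⟨a', b', hb⟩ := hb
  have := mappingCone.quasiIso_descShortComplex hT
  have := quasiIso_mappingCone_map (p ≫ T.f) T.f p (𝟙 _) (by simp)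
  refine ⟨mappingCone (p ≫ T.f), mappingCone.map (p ≫ T.f) T.f p (𝟙 _) (by simp) ≫
    mappingCone.descShortComplex T, ⟨min (a - 1) a', max b b', fun i hi => ?_⟩, fun i => ?_,
    inferInstance⟩
  · rw [mappingCone.isZero_X_iff]
    exact ⟨hP _ (by omega), hb _ (by omega)⟩
  · let ε := ((HomologicalComplex.homotopyCofiber.XIsoBiprod (p ≫ T.f) i (i + 1) (by simp)) ≪≫
      ModuleCat.biprodIsoProd _ _).toLinearEquiv.symm
    obtain ⟨_, _⟩ := hfP (i + 1)
    obtain ⟨_, _⟩ := hfp i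
    exact ⟨Module.Finite.equiv ε, Module.Projective.of_equiv ε⟩

end Perfect

section LocalGlobalPerfect

attribute [local instance] algBase algBase_tower linearModuleCat

variable {R S : Type u} [CommRing R] [Ring S] [Algebra R S]

theorem projective_of_forall_maximal (X : ModuleCat.{u} S) [Module.FinitePresentation S X]
    (H : ∀ (m : Ideal R) [m.IsMaximal], HasLocalProjectiveDimensionLE m.primeCompl X 0) :
    Projective X := by
  obtain ⟨Q, π, _, _, _⟩ := exists_finite_projective_epi X
  obtain ⟨s, hs⟩ : 𝟙 X ∈ LinearMap.range (Linear.rightComp R X π) :=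
    mem_of_forall_maximal _ _ fun m _ => by
      obtain ⟨σ, a, ha, hσ⟩ := (H m).exists_smul_id_eq_comp π
      exact ⟨a, ha, σ, hσ⟩
  exact (Retract.mk s π hs).projective

theorem isPerfect_of_forall_maximal [IsNoetherianRing S] (n : ℕ) (X : ModuleCat.{u} S)
    [Module.Finite S X]
    (H : ∀ (m : Ideal R) [m.IsMaximal], HasLocalProjectiveDimensionLE m.primeCompl X n) :
    IsPerfect (inDegreeZero X) := by
  induction n generalizing X with
  | zero =>
    have : Module.FinitePresentation S X := Module.finitePresentation_of_finite S X
    have := projective_of_forall_maximal X H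
    exact isPerfect_inDegreeZero_of_projective X
  | succ n ih =>
    obtain ⟨Q, π, _, _, hπ⟩ := exists_finite_projective_epi X
    have hT := LinearMap.shortExact_shortComplexKer ((ModuleCat.epi_iff_surjective π).1 hπ)
    have hK := ih π.hom.shortComplexKer.X₁ fun m _ => (H m).X₁_of_shortExact hT
    exact hK.X₃_of_shortExact
      (hT.map_of_exact (HomologicalComplex.single (ModuleCat.{u} S) (ComplexShape.up ℤ) 0))
      (isBounded_inDegreeZero Q) (finite_projective_inDegreeZero_X Q)

end LocalGlobalPerfect

section Bimodule

attribute [local instance] algBase algBase_tower linearModuleCat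

lemma IsTilting.of_iso {k A : Type u} [CommRing k] [Ring A] [Algebra k A]
    {M M' : CochainComplex (ModuleCat.{u} (Env k A)) ℤ} (e : M ≅ M') (hM : IsTilting k A M) :
    IsTilting k A M' where
  biperfect :=
    ⟨hM.biperfect.1.of_quasiIso (((leftRes k A).mapHomologicalComplex (.up ℤ)).mapIso e).hom,
      hM.biperfect.2.of_quasiIso (((rightRes k A).mapHomologicalComplex (.up ℤ)).mapIso e).hom⟩
  left_mul := hM.left_mul.of_iso e
  right_mul := hM.right_mul.of_iso e

lemma finite_restrictScalars {R S E : Type u} [CommRing R] [Ring S] [Algebra R S] [Ring E]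
    [Algebra R E] [Module.Finite R E] (f : S →ₐ[R] E) (M : ModuleCat.{u} E) [Module.Finite E M] :
    Module.Finite S ((ModuleCat.restrictScalars f.toRingHom).obj M) := by
  have : Module.Finite R M := Module.Finite.trans E M
  have : Module.Finite R ((ModuleCat.restrictScalars f.toRingHom).obj M) :=
    Module.Finite.equiv (algResEquiv f M).symm
  exact Module.Finite.of_restrictScalars_finite R S _

section Localization

variable {R R' A A' : Type u} [CommRing R] [CommRing R'] [Algebra R R'] [Ring A] [Ring A']
  [Algebra R A] [Algebra R A'] [Algebra R' A'] [IsScalarTower R R' A'] (W : Submonoid R)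
  (φ : A →ₐ[R] A') [IsLocalizedModule W φ.toLinearMap] {M : ModuleCat.{u} (Env R A)}
  {M' : ModuleCat.{u} (Env R' A')} (k : M ⟶ (algRes (envMap R' φ)).obj M')
  (hk : IsLocalizationHom W k) {n : ℕ}

include k hk

lemma hasLocalProjectiveDimensionLE_leftRes
    (h : HasProjectiveDimensionLE ((leftRes R' A').obj M') n) :
    HasLocalProjectiveDimensionLE W ((leftRes R A).obj M) n :=
  .restrictScalars (f := inlAlg R R A) (f' := inlAlg R R' A') (envMap_comp_inlAlg φ) k hk h

lemma hasLocalProjectiveDimensionLE_rightRes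
    (h : HasProjectiveDimensionLE ((rightRes R' A').obj M') n) :
    HasLocalProjectiveDimensionLE W ((rightRes R A).obj M) n :=
  .restrictScalars (f := inrAlg R R A) (f' := inrAlg R R' A') (envMap_comp_inrAlg φ) k hk h

end Localization

variable {R Γ : Type u} [CommRing R] [Ring Γ] [Algebra R Γ]

theorem isBiperfect_of_forall_maximal [IsNoetherianRing Γ] [IsNoetherianRing Γᵐᵒᵖ]
    (M : ModuleCat.{u} (Env R Γ)) [Module.Finite Γ ((leftRes R Γ).obj M)]
    [Module.Finite Γᵐᵒᵖ ((rightRes R Γ).obj M)] (n : ℕ)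
    (hr : ∀ (m : Ideal R) [m.IsMaximal], HasProjectiveDimensionLE
      ((rightRes (Localization.AtPrime m) (LocAlg m Γ)).obj (locObj m Γ M)) n)
    (hl : ∀ (m : Ideal R) [m.IsMaximal], HasProjectiveDimensionLE
      ((leftRes (Localization.AtPrime m) (LocAlg m Γ)).obj (locObj m Γ M)) n) :
    IsBiperfect R Γ (inDegreeZero M) := by
  have hk (m : Ideal R) [m.IsMaximal] := isLocalizationHom_toLocObj m Γ M
  have hX := isPerfect_of_forall_maximal (R := R) n ((leftRes R Γ).obj M) fun m _ =>
    hasLocalProjectiveDimensionLE_leftRes m.primeCompl (toLocAlg m Γ) (toLocObj m Γ M) (hk m) (hl m)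
  have hX' := isPerfect_of_forall_maximal (R := R) n ((rightRes R Γ).obj M) fun m _ =>
    hasLocalProjectiveDimensionLE_rightRes m.primeCompl (toLocAlg m Γ) (toLocObj m Γ M) (hk m)
      (hr m)
  exact ⟨hX.mapHomologicalComplex_inDegreeZero _ M, hX'.mapHomologicalComplex_inDegreeZero _ M⟩

/-- Localization commutes with regarding a bimodule as a complex concentrated in degree zero. -/
def locComplexInDegreeZeroIso (m : Ideal R) [m.IsPrime] (M : ModuleCat.{u} (Env R Γ)) :
    locComplex m Γ (inDegreeZero M) ≅ inDegreeZero (locObj m Γ M) :=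
  (HomologicalComplex.singleMapHomologicalComplex (locFunctor m Γ) (ComplexShape.up ℤ) 0).app M

end Bimodule

end TiltingBimod

end

open TiltingBimod in
theorem mainTheorem7_general (R : Type u) [CommRing R] (Γ : Type u) [Ring Γ] [Algebra R Γ] :
    (∀ M : CochainComplex (ModuleCat.{u} (Env R Γ)) ℤ,
      IsBiperfect R Γ M →
      (∀ (m : Ideal R) [m.IsMaximal],
        IsTilting (Localization.AtPrime m) (LocAlg m Γ) (locComplex m Γ M)) →
      IsTilting R Γ M) ∧
    (IsNoetherianRing Γ → IsNoetherianRing Γᵐᵒᵖ →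
      ∀ M : ModuleCat.{u} (Env R Γ),
      Module.Finite Γ ((leftRes R Γ).obj M) →
      Module.Finite Γᵐᵒᵖ ((rightRes R Γ).obj M) →
      (∃ n : ℕ, ∀ (m : Ideal R) [m.IsMaximal],
        HasProjectiveDimensionLE
          ((rightRes (Localization.AtPrime m) (LocAlg m Γ)).obj (locObj m Γ M)) n ∧
        HasProjectiveDimensionLE
          ((leftRes (Localization.AtPrime m) (LocAlg m Γ)).obj (locObj m Γ M)) n ∧
        IsTilting (Localization.AtPrime m) (LocAlg m Γ) (inDegreeZero (locObj m Γ M))) →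
      IsTilting R Γ (inDegreeZero M)) := by
  refine ⟨fun M hM H => isTilting_of_forall_maximal hM H, ?_⟩
  rintro _ _ M _ _ ⟨n, H⟩
  have hM := isBiperfect_of_forall_maximal M n (fun m _ => (H m).1) fun m _ => (H m).2.1
  exact isTilting_of_forall_maximal hM
    fun m _ => (H m).2.2.of_iso (locComplexInDegreeZeroIso m M).symm

open TiltingBimod in
theorem mainTheorem7 (K : Type*) [Field K] (R : Type u) [CommRing R] [Algebra K R]
    [IsNoetherianRing R] (Γ : Type u) [Ring Γ] [Algebra R Γ] [Module.Finite R Γ] :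
    (∀ M : CochainComplex (ModuleCat.{u} (Env R Γ)) ℤ,
      (∀ i, Module.Finite (Env R Γ) (M.X i)) →
      IsBiperfect R Γ M →
      (∀ (m : Ideal R) [m.IsMaximal],
        IsTilting (Localization.AtPrime m) (LocAlg m Γ) (locComplex m Γ M)) →
      IsTilting R Γ M) ∧
    (∀ M : ModuleCat.{u} (Env R Γ),
      Module.Finite (Env R Γ) M →
      (∃ n : ℕ, ∀ (m : Ideal R) [m.IsMaximal],
        HasProjectiveDimensionLE
          ((rightRes (Localization.AtPrime m) (LocAlg m Γ)).obj (locObj m Γ M)) n ∧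
        HasProjectiveDimensionLE
          ((leftRes (Localization.AtPrime m) (LocAlg m Γ)).obj (locObj m Γ M)) n ∧
        IsTilting (Localization.AtPrime m) (LocAlg m Γ) (inDegreeZero (locObj m Γ M))) →
      IsTilting R Γ (inDegreeZero M)) := by
  have : Module.Finite R Γᵐᵒᵖ := Module.Finite.equiv (opLinearEquiv R : Γ ≃ₗ[R] Γᵐᵒᵖ)
  refine ⟨fun M _ => (mainTheorem7_general R Γ).1 M, fun M _ => ?_⟩
  exact (mainTheorem7_general R Γ).2 (.of_finite R Γ) (.of_finite R Γᵐᵒᵖ) M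
    (finite_restrictScalars (inlAlg R R Γ) M) (finite_restrictScalars (inrAlg R R Γ) M)
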